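/- Let $G=(V,E_\to,E_\leftrightarrow)$ be a mixed graph: $V$ is a finite set, $E_\to$ is a set of directed edges $i\to j$ and $E_\leftrightarrow$ a set of (unoriented) bi-directed edges $i\leftrightarrow j$, both with $i\neq j$; the same two nodes may be joined by several edges of different kind or direction. Put $\mathrm{pa}(i)=\{j: j\to i\in E_\to\}$ and $\mathrm{sib}(i)=\{j: j\leftrightarrow i\in E_\leftrightarrow\}$, and let $G_{-i}$ be the subgraph induced on $V\setminus\{i\}$. A half-collider path is a path $i_1,\dots,i_k$ ($k\ge 1$, vertices not necessarily distinct) whose edges are all bi-directed, or whose first edge is $i_1\to i_2$ and whose other edges are all bi-directed; the trivial path $i_1$ and the single edge $i_1\to i_2$ are allowed. Its bi-directed portion is $\{i_1,\dots,i_k\}$ in the first case and $\{i_2,\dots,i_k\}$ in the second. A system of half-collider paths from $S_b$ to $S_e$ is a collection $\pi^1,\dots,\pi^s$ with $s=|S_b|=|S_e|$ such that each $\pi^l$ is a half-collider path from a node of $S_b$ to a node of $S_e$, each node of $S_b$ is the first node of some $\pi^l$, and each node of $S_e$ is the last node of some $\pi^l$. Let $\mathbf B(G)$ be the set of real $V\times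 V$ matrices $B=(\beta_{ij})$ with $I-B$ invertible and $\beta_{ij}=0$ whenever $j\to i\notin E_\to$, and let $\mathbf\Omega(G)$ be the set of symmetric positive definite real $V\times V$ matrices $\Omega=(\omega_{ij})$ with $\omega_{ij}=0$ whenever $i\ne j$ and $i\leftrightarrow j\notin E_\leftrightarrow$. Let $N\ge|V|$. For $Y\in\mathbb R^{V\times N}$ and $S=\frac1N YY^T$ let $$\ell_{G,Y}(\Omega,B)=-\log\det\bigl((I-B)^{-1}\Omega(I-B)^{-T}\bigr)-\mathrm{tr}\bigl\{(I-B)^T\Omega^{-1}(I-B)S\bigr\},\qquad (B,\Omega)\in\mathbf B(G)\times\mathbf\Omega(G).$$ The block update at node $i$ replaces the current pair $(B,\Omega)$ by a maximizer of $\ell_{G,Y}$ over those pairs in $\mathbf B(G)\times\mathbf\Omega(G)$ that agree with $(B,\Omega)$ outside the $i$-th row of $B$ and outside the $i$-th row and column of $\Omega$; it is unique and feasible if exactly one such maximizer exists. Fix an order of the nodes. One iteration of the block-coordinate descent (BCD) algorithm carries out the block updates at all nodes $i\in V$, one after the other, in this order. "Generic" means: outside a set of Lebesgue measure zero, in the coordinates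 formed by the entries of $Y$ and the free entries $\beta_{ij}$ ($j\to i\in E_\to$) of $B_0$ and $\omega_{ii}$ ($i\in V$), $\omega_{ij}$ ($i\leftrightarrow j\in E_\leftrightarrow$) of $\Omega_0$. Then the following two statements are equivalent: (a) For every $i\in V$, the induced subgraph $G_{-i}$ contains a system of half-collider paths from a subset of $V\setminus(\mathrm{pa}(i)\cup\{i\})$ to $\mathrm{sib}(i)$ whose bi-directed portions are pairwise disjoint. (b) For generic triples $(Y,B_0,\Omega_0)\in\mathbb R^{V\times N}\times\mathbf B(G)\times\mathbf\Omega(G)$, any finite number of iterations of the BCD algorithm for $\ell_{G,Y}$ started at $(B_0,\Omega_0)$ have unique and feasible block updates. -/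

import Mathlib

open MeasureTheory

/-- A mixed graph on the vertex set `V`: directed edges `i → j` (written `dir i j`) and bi-directed
edges `i ↔ j` (written `bi.Adj i j`), neither of them with self-loops. The same pair of nodes may
carry edges of both kinds and directed edges in both directions. -/
structure MixedGraph (V : Type*) where
  dir : V → V → Prop
  dir_irrefl : ∀ i, ¬ dir i i
  bi : SimpleGraph V

namespace MixedGraph

/-! ### Graphical notions -/

section Graph

variable {V : Type*}

/-- The parents of `i`. -/
def pa (G : MixedGraph V) (i : V) : Set V := {j | G.dir j i}

/-- The siblings of `i`. -/
def sib (G : MixedGraph V) (i : V) : Set V := {j | G.bi.Adj j i}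

/-- The induced subgraph on a set of nodes. -/
def induce (G : MixedGraph V) (s : Set V) : MixedGraph s where
  dir a b := G.dir a b
  dir_irrefl a := G.dir_irrefl a
  bi := G.bi.induce s

/-- A half-collider path from `a` to `b`, with not necessarily distinct vertices: either all of its
edges are bi-directed (possibly there are none), or its first edge is directed, `a → c`, and all
the other edges (possibly none) are bi-directed. -/
inductive HalfColliderPath (G : MixedGraph V) : V → V → Type _
  | bidirected {a b : V} (w : G.bi.Walk a b) : HalfColliderPath G a b
  | directed {a c b : V} (h : G.dir a c) (w : G.bi.Walk c b) : HalfColliderPath G a b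

/-- The bi-directed portion: all the nodes of the path, except that the tail of an initial directed
edge is not counted (as the first node). -/
def HalfColliderPath.biPortion {G : MixedGraph V} {a b : V} : G.HalfColliderPath a b → Set V
  | .bidirected w => {v | v ∈ w.support}
  | .directed _ w => {v | v ∈ w.support}

/-- A system of half-collider paths from `Sb` to `Se` (in use, `V` is finite). -/
structure HalfColliderSystem (G : MixedGraph V) (Sb Se : Set V) where
  s : ℕ
  card_begin : Sb.ncard = s
  card_end : Se.ncard = s
  first : Fin s → V
  last : Fin s → V
  path : ∀ l, G.HalfColliderPath (first l) (last l)
  first_mem : ∀ l, first l ∈ Sb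
  last_mem : ∀ l, last l ∈ Se
  first_surj : ∀ v ∈ Sb, ∃ l, first l = v
  last_surj : ∀ v ∈ Se, ∃ l, last l = v

/-- The induced subgraph `G_{-i}` contains a system of half-collider paths from a subset of
`V ∖ (pa(i) ∪ {i})` to `sib(i)` such that the bi-directed portions are pairwise disjoint. -/
def HalfColliderCondition (G : MixedGraph V) (i : V) : Prop :=
  ∃ Sb : Set ({i}ᶜ : Set V), (∀ v ∈ Sb, (v : V) ∉ G.pa i ∪ {i}) ∧
    ∃ P : (G.induce {i}ᶜ).HalfColliderSystem Sb {v | (v : V) ∈ G.sib i},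
      Pairwise fun k l => Disjoint (P.path k).biPortion (P.path l).biPortion

end Graph

/-! ### The linear structural equation model and its log-likelihood function -/

section Model

variable {V : Type*} [Fintype V] [DecidableEq V]

/-- The parameter set `𝐁(G)`. -/
def BSet (G : MixedGraph V) : Set (Matrix V V ℝ) :=
  {B | IsUnit (1 - B) ∧ ∀ i j, ¬ G.dir j i → B i j = 0}

/-- The parameter set `𝛀(G)`; `PosDef` includes symmetry. -/
def OmegaSet (G : MixedGraph V) : Set (Matrix V V ℝ) :=
  {Om | Om.PosDef ∧ ∀ i j, i ≠ j → ¬ G.bi.Adj j i → Om i j = 0}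

/-- The log-likelihood function
`-log det((I-B)⁻¹ Ω (I-B)⁻ᵀ) - tr((I-B)ᵀ Ω⁻¹ (I-B) S)` with `S = Y Yᵀ / N`, at `(B, Ω)`. -/
noncomputable def logLik {N : ℕ} (Y : Matrix V (Fin N) ℝ)
    (θ : Matrix V V ℝ × Matrix V V ℝ) : ℝ :=
  - Real.log ((1 - θ.1)⁻¹ * θ.2 * ((1 - θ.1)⁻¹).transpose).det
    - ((1 - θ.1).transpose * θ.2⁻¹ * (1 - θ.1) * ((1 / (N : ℝ)) • (Y * Y.transpose))).trace

/-! ### Block-coordinate descent -/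

/-- The feasible set of the `i`-th block update problem at `θ = (B, Ω)`: pairs
`(B', Ω') ∈ 𝐁(G) × 𝛀(G)` (so `Ω'` is positive definite and `I - B'` invertible) that agree with
`(B, Ω)` off the `i`-th row of `B` and off the `i`-th row and column of `Ω`. -/
def blockFeasible (G : MixedGraph V) (i : V) (θ : Matrix V V ℝ × Matrix V V ℝ) :
    Set (Matrix V V ℝ × Matrix V V ℝ) :=
  {θ' | θ'.1 ∈ G.BSet ∧ θ'.2 ∈ G.OmegaSet ∧ (∀ a b, a ≠ i → θ'.1 a b = θ.1 a b) ∧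
    (∀ a b, a ≠ i → b ≠ i → θ'.2 a b = θ.2 a b)}

/-- `θ'` is a feasible solution of the `i`-th block update problem at `θ`. -/
def IsBlockSolution (G : MixedGraph V) {N : ℕ} (Y : Matrix V (Fin N) ℝ) (i : V)
    (θ θ' : Matrix V V ℝ × Matrix V V ℝ) : Prop :=
  θ' ∈ G.blockFeasible i θ ∧ IsMaxOn (logLik Y) (G.blockFeasible i θ) θ'

/-- Block-coordinate descent for the data `Y`, started at `θ` and visiting successively the nodes
in the list, has a unique and feasible block update at each step. -/
def UniqueFeasibleUpdates (G : MixedGraph V) {N : ℕ} (Y : Matrix V (Fin N) ℝ) :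
    List V → Matrix V V ℝ × Matrix V V ℝ → Prop
  | [], _ => True
  | i :: l, θ => ∃ θ', (G.IsBlockSolution Y i θ θ' ∧ ∀ θ'', G.IsBlockSolution Y i θ θ'' → θ'' = θ') ∧
      UniqueFeasibleUpdates G Y l θ'

/-! ### Generic triples -/

/-- The positions of the free entries of `B`. -/
abbrev DirEdge (G : MixedGraph V) : Type _ := {e : V × V // G.dir e.1 e.2}

/-- The positions of the free entries of `Ω`: the diagonal and the bi-directed edges. -/
abbrev OmegaIndex (G : MixedGraph V) : Type _ := V ⊕ {e : Sym2 V // e ∈ G.bi.edgeSet}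

open scoped Classical in
/-- The matrix `B` with free entries `β`; the coefficient of `j → i` is at position `(i, j)`. -/
noncomputable def toB (G : MixedGraph V) (β : G.DirEdge → ℝ) : Matrix V V ℝ :=
  Matrix.of fun i j => if h : G.dir j i then β ⟨(j, i), h⟩ else 0

open scoped Classical in
/-- The symmetric matrix `Ω` with free entries `ω`. -/
noncomputable def toOmega (G : MixedGraph V) (ω : G.OmegaIndex → ℝ) : Matrix V V ℝ :=
  Matrix.of fun i j => if i = j then ω (Sum.inl i)
    else if h : s(i, j) ∈ G.bi.edgeSet then ω (Sum.inr ⟨s(i, j), h⟩) else 0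

open scoped Classical in
/-- A property of triples `(Y, (B, Ω))` holds for generic triples in `ℝ^{V × N} × 𝐁(G) × 𝛀(G)`:
the exceptional triples form a Lebesgue null set in the coordinates given by the entries of `Y`
and the free entries of `B` and `Ω`. -/
def ForGenericTriples (G : MixedGraph V) (N : ℕ)
    (P : Matrix V (Fin N) ℝ → Matrix V V ℝ × Matrix V V ℝ → Prop) : Prop :=
  ∀ᵐ p : (V → Fin N → ℝ) × (G.DirEdge → ℝ) × (G.OmegaIndex → ℝ),
    G.toB p.2.1 ∈ G.BSet → G.toOmega p.2.2 ∈ G.OmegaSet →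
      P (Matrix.of p.1) (G.toB p.2.1, G.toOmega p.2.2)

end Model

end MixedGraph

/-!
The block update at `i` is a regression problem. Its feasible pairs are parametrized by a vector `v`
of coefficients, one for `i` (normalized to one), one for each parent and one for each sibling of
`i`, and by a conditional variance `η > 0`. In these coordinates the log-likelihood is a constant
plus `log ((c ⬝ᵥ v)² / η) - (v ⬝ᵥ A *ᵥ v) / (N η)`, where `c` collects the cofactors of the `i`-th
row of `1 - B` and `A` is the Gram matrix of the regressors. A direction in the kernel of `A` yields
further maximizers, so uniqueness forces the regressors to be linearly independent; if `A` is
invertible, the maximizer is the rescaled solution of `A u = c`, unless `u` vanishes at `i`.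

Linear independence of the regressors amounts to independence of the rows at `sib i` and the columns
off `pa i` of `Ω₋ᵢ⁻¹ (1 - B₋ᵢ)`. A nonzero term in the determinant expansion of a suitable bordered
matrix is a permutation whose orbits contain a half-collider system with disjoint bi-directed
portions. Conversely, such a system gives matrices for which the relevant minor is diagonally
dominant.

Finally, every block update is a rational function of the data and the parameters. If the sample
covariance matrix equals the model covariance matrix of `(B, Ω)`, then `(B, Ω)` is fixed by all
block updates. So no denominator of any iterate vanishes at this point, and hence all iterates are
well-defined for generic data and starting values.
-/

open scoped Matrix

/-! ### Functions that are rational along the lines through a point -/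

section RegularAt

theorem ae_mem_of_forall_ae_add_smul_mem {E : Type*} [NormedAddCommGroup E] [NormedSpace ℝ E]
    [FiniteDimensional ℝ E] [MeasurableSpace E] [BorelSpace E] (μ : Measure E)
    [μ.IsAddHaarMeasure] {s : Set E} (hs : MeasurableSet s) (p : E)
    (h : ∀ y, ∀ᵐ t : ℝ, p + t • y ∈ s) : ∀ᵐ x ∂μ, x ∈ s := by
  have hline : Measurable fun q : E × ℝ => p + q.2 • q.1 := by fun_prop
  have hcomm : ∀ᵐ t : ℝ, ∀ᵐ y ∂μ, p + t • y ∈ s :=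
    (Measure.ae_ae_comm (p := fun y t => p + t • y ∈ s) (hline hs)).1 (.of_forall h)
  obtain ⟨t, ht, ht0⟩ := (hcomm.and (by simp [ae_iff] : ∀ᵐ t : ℝ, t ≠ 0)).exists
  have hsmul : μ ((t • ·) ⁻¹' ((p + ·) ⁻¹' sᶜ)) = 0 := ht
  rw [Measure.addHaar_preimage_smul μ ht0, measure_preimage_add, mul_eq_zero] at hsmul
  exact hsmul.resolve_left (by simp [ht0])

variable {E : Type*} [AddCommGroup E] [Module ℝ E] [MeasurableSpace E]

/-- `f` is measurable and, along every line through `p`, it is given by a rational function whose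
denominator does not vanish at `p`, wherever this denominator does not vanish. Such functions are
closed under the operations of linear algebra, and `f p ≠ 0` forces `f ≠ 0` almost everywhere. -/
def RegularAt (p : E) (f : E → ℝ) : Prop :=
  Measurable f ∧ ∀ y : E, ∃ a b : Polynomial ℝ, b.eval 0 ≠ 0 ∧
    ∀ t : ℝ, b.eval t ≠ 0 → f (p + t • y) = a.eval t / b.eval t

namespace RegularAt

variable {p : E} {f g : E → ℝ}

theorem const (c : ℝ) : RegularAt p fun _ => c :=
  ⟨measurable_const, fun _ => ⟨Polynomial.C c, 1, by simp, by simp⟩⟩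

theorem of_isLinearMap (hf : IsLinearMap ℝ f) (hm : Measurable f) : RegularAt p f :=
  ⟨hm, fun y => ⟨Polynomial.C (f p) + Polynomial.C (f y) * Polynomial.X, 1, by simp, fun t _ => by
    rw [hf.map_add, hf.map_smul]
    simp only [smul_eq_mul, Polynomial.eval_add, Polynomial.eval_mul, Polynomial.eval_C,
      Polynomial.eval_X, Polynomial.eval_one, div_one, mul_comm]⟩⟩

theorem add (hf : RegularAt p f) (hg : RegularAt p g) : RegularAt p fun x => f x + g x := by
  refine ⟨hf.1.add hg.1, fun y => ?_⟩
  obtain ⟨a, b, hb, h⟩ := hf.2 y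
  obtain ⟨a', b', hb', h'⟩ := hg.2 y
  refine ⟨a * b' + b * a', b * b', by simp [hb, hb'], fun t ht => ?_⟩
  simp only [Polynomial.eval_mul, ne_eq, mul_eq_zero, not_or] at ht
  simp only [h t ht.1, h' t ht.2, div_add_div _ _ ht.1 ht.2,
    Polynomial.eval_add, Polynomial.eval_mul]

theorem mul (hf : RegularAt p f) (hg : RegularAt p g) : RegularAt p fun x => f x * g x := by
  refine ⟨hf.1.mul hg.1, fun y => ?_⟩
  obtain ⟨a, b, hb, h⟩ := hf.2 y
  obtain ⟨a', b', hb', h'⟩ := hg.2 y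
  refine ⟨a * a', b * b', by simp [hb, hb'], fun t ht => ?_⟩
  simp only [Polynomial.eval_mul, ne_eq, mul_eq_zero, not_or] at ht
  simp only [h t ht.1, h' t ht.2, div_mul_div_comm, Polynomial.eval_mul]

theorem inv (hf : RegularAt p f) (h0 : f p ≠ 0) : RegularAt p fun x => (f x)⁻¹ := by
  refine ⟨hf.1.inv, fun y => ?_⟩
  obtain ⟨a, b, hb, h⟩ := hf.2 y
  have ha : a.eval 0 ≠ 0 := fun ha => h0 (by simpa [ha] using h 0 hb)
  refine ⟨b * b, a * b, by simp [ha, hb], fun t ht => ?_⟩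
  simp only [Polynomial.eval_mul, ne_eq, mul_eq_zero, not_or] at ht ⊢
  rw [h t ht.2, inv_div, mul_div_mul_right _ _ ht.2]

theorem neg (hf : RegularAt p f) : RegularAt p fun x => -f x := by
  simpa using (const (-1)).mul hf

theorem sub (hf : RegularAt p f) (hg : RegularAt p g) : RegularAt p fun x => f x - g x := by
  simpa [sub_eq_add_neg] using hf.add hg.neg

theorem div (hf : RegularAt p f) (hg : RegularAt p g) (h0 : g p ≠ 0) :
    RegularAt p fun x => f x / g x := by
  simpa [div_eq_mul_inv] using hf.mul (hg.inv h0)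

theorem sum {ι : Type*} (s : Finset ι) {F : ι → E → ℝ} (h : ∀ i ∈ s, RegularAt p (F i)) :
    RegularAt p fun x => ∑ i ∈ s, F i x := by
  classical
  induction s using Finset.induction_on with
  | empty => simpa using const 0
  | insert i s hi ih =>
    simp only [Finset.sum_insert hi]
    exact (h i (by simp)).add (ih fun j hj => h j (by simp [hj]))

theorem prod {ι : Type*} (s : Finset ι) {F : ι → E → ℝ} (h : ∀ i ∈ s, RegularAt p (F i)) :
    RegularAt p fun x => ∏ i ∈ s, F i x := by
  classical
  induction s using Finset.induction_on with
  | empty => simpa using const 1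
  | insert i s hi ih =>
    simp only [Finset.prod_insert hi]
    exact (h i (by simp)).mul (ih fun j hj => h j (by simp [hj]))

theorem dotProduct {n : Type*} [Fintype n] {u v : E → n → ℝ} (hu : ∀ j, RegularAt p fun x => u x j)
    (hv : ∀ j, RegularAt p fun x => v x j) : RegularAt p fun x => u x ⬝ᵥ v x :=
  sum _ fun j _ => (hu j).mul (hv j)

theorem ae_add_smul_ne_zero (hf : RegularAt p f) (h0 : f p ≠ 0) (y : E) :
    ∀ᵐ t : ℝ, f (p + t • y) ≠ 0 := by
  obtain ⟨a, b, hb, h⟩ := hf.2 y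
  have ha : a.eval 0 ≠ 0 := fun ha => h0 (by simpa [ha] using h 0 hb)
  have hab : a * b ≠ 0 := fun h => mul_ne_zero ha hb (by rw [← Polynomial.eval_mul, h]; simp)
  refine measure_mono_null (fun t ht => ?_)
    ((a * b).roots.toFinset.finite_toSet.measure_zero volume)
  simp only [Set.mem_compl_iff, Set.mem_ofPred_eq, not_not] at ht
  by_contra hne
  simp only [Finset.mem_coe, Multiset.mem_toFinset, Polynomial.mem_roots hab,
    Polynomial.IsRoot.def, Polynomial.eval_mul, mul_eq_zero, not_or] at hne
  rw [h t hne.2] at ht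
  exact div_ne_zero hne.1 hne.2 ht

theorem ae_ne_zero {E : Type*} [NormedAddCommGroup E] [NormedSpace ℝ E] [FiniteDimensional ℝ E]
    [MeasurableSpace E] [BorelSpace E] {p : E} {f : E → ℝ} (μ : Measure E) [μ.IsAddHaarMeasure]
    (hf : RegularAt p f) (h0 : f p ≠ 0) : ∀ᵐ x ∂μ, f x ≠ 0 :=
  ae_mem_of_forall_ae_add_smul_mem μ (hf.1 (measurableSet_singleton 0).compl) p
    (hf.ae_add_smul_ne_zero h0)

end RegularAt

/-- All the entries of a matrix-valued function are regular at `p`. -/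
def MatrixRegularAt {m n : Type*} (p : E) (M : E → Matrix m n ℝ) : Prop :=
  ∀ i j, RegularAt p fun x => M x i j

namespace MatrixRegularAt

variable {l m n : Type*} {p : E}

theorem const (A : Matrix m n ℝ) : MatrixRegularAt p fun _ => A := fun _ _ => RegularAt.const _

theorem sub {M M' : E → Matrix m n ℝ} (h : MatrixRegularAt p M) (h' : MatrixRegularAt p M') :
    MatrixRegularAt p fun x => M x - M' x := fun i j => (h i j).sub (h' i j)

theorem mul [Fintype m] {M : E → Matrix l m ℝ} {M' : E → Matrix m n ℝ} (h : MatrixRegularAt p M)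
    (h' : MatrixRegularAt p M') : MatrixRegularAt p fun x => M x * M' x := fun i j =>
  RegularAt.dotProduct (h i) fun k => h' k j

theorem transpose {M : E → Matrix m n ℝ} (h : MatrixRegularAt p M) :
    MatrixRegularAt p fun x => (M x).transpose := fun i j => h j i

theorem mulVec [Fintype n] {M : E → Matrix m n ℝ} {v : E → n → ℝ} (h : MatrixRegularAt p M)
    (hv : ∀ j, RegularAt p fun x => v x j) (i : m) : RegularAt p fun x => (M x).mulVec (v x) i :=
  RegularAt.dotProduct (h i) hv

theorem vecMul [Fintype m] {M : E → Matrix m n ℝ} {v : E → m → ℝ}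
    (hv : ∀ i, RegularAt p fun x => v x i) (h : MatrixRegularAt p M) (j : n) :
    RegularAt p fun x => Matrix.vecMul (v x) (M x) j :=
  RegularAt.dotProduct hv fun i => h i j

theorem det [Fintype n] [DecidableEq n] {M : E → Matrix n n ℝ} (h : MatrixRegularAt p M) :
    RegularAt p fun x => (M x).det := by
  simp only [Matrix.det_apply']
  exact RegularAt.sum _ fun σ _ => (RegularAt.const _).mul (RegularAt.prod _ fun i _ => h _ _)

theorem adjugate [Fintype n] [DecidableEq n] {M : E → Matrix n n ℝ} (h : MatrixRegularAt p M) :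
    MatrixRegularAt p fun x => (M x).adjugate := fun i j => by
  simp only [Matrix.adjugate_apply]
  refine det fun k l => ?_
  by_cases hk : k = j
  · subst hk; simpa using RegularAt.const _
  · simpa [hk] using h k l

theorem inv [Fintype n] [DecidableEq n] {M : E → Matrix n n ℝ} (h : MatrixRegularAt p M)
    (h0 : (M p).det ≠ 0) : MatrixRegularAt p fun x => (M x)⁻¹ := fun i j => by
  simp only [Matrix.inv_def, Ring.inverse_eq_inv', Matrix.smul_apply, smul_eq_mul]
  exact (h.det.inv h0).mul (h.adjugate i j)

end MatrixRegularAt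

end RegularAt

/-! ### From minors to systems of half-collider paths -/

theorem linearIndependent_row_iff {m n R : Type*} [Fintype m] [CommRing R] {M : Matrix m n R} :
    LinearIndependent R M.row ↔ ∀ y, y ᵥ* M = 0 → y = 0 := by
  rw [← Matrix.vecMul_injective_iff]
  exact injective_iff_map_eq_zero M.vecMulLinear

theorem exists_injective_det_submatrix_ne_zero {m n K : Type*} [Fintype m] [DecidableEq m]
    [Finite n] [Field K] {R : Matrix m n K} (hR : LinearIndependent K R.row) :
    ∃ a : m → n, Function.Injective a ∧ (R.submatrix id a).det ≠ 0 := by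
  have := Fintype.ofFinite n
  obtain ⟨κ, a, ha, hspan, hli⟩ := exists_linearIndependent' K R.col
  have : Finite κ := hli.finite
  have := Fintype.ofFinite κ
  have hcard : Fintype.card κ = Fintype.card m := by
    rw [← finrank_span_eq_card hli, hspan, ← hR.rank_matrix, Matrix.rank_eq_finrank_span_cols]
  let e : m ≃ κ := Fintype.equivOfCardEq hcard.symm
  refine ⟨a ∘ e, ha.comp e.injective, ?_⟩
  rw [← isUnit_iff_ne_zero, ← Matrix.isUnit_iff_isUnit_det,
    ← Matrix.linearIndependent_cols_iff_isUnit]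
  exact hli.comp e e.injective

theorem exists_perm_forall_apply_ne_zero {n R : Type*} [Fintype n] [DecidableEq n] [CommRing R]
    {M : Matrix n n R} (h : M.det ≠ 0) : ∃ π : Equiv.Perm n, ∀ x, M x (π x) ≠ 0 := by
  rw [← Matrix.det_transpose, Matrix.det_apply] at h
  obtain ⟨σ, -, hσ⟩ := Finset.exists_ne_zero_of_sum_ne_zero h
  refine ⟨σ, fun x hx => hσ ?_⟩
  rw [Finset.prod_eq_zero (Finset.mem_univ x) (by simpa using hx), smul_zero]

theorem det_fromBlocks_submatrix_ne_zero {m n K : Type*} [Fintype m] [DecidableEq m] [Fintype n]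
    [DecidableEq n] [Field K] {A M : Matrix n n K} {a b : m → n} (hA : A.det ≠ 0)
    (h : ((A⁻¹ * M).submatrix b a).det ≠ 0) :
    (Matrix.fromBlocks A (M.submatrix id a) ((1 : Matrix n n K).submatrix b id) 0).det ≠ 0 := by
  have := Matrix.invertibleOfIsUnitDet A (isUnit_iff_ne_zero.2 hA)
  have hsub : (1 : Matrix n n K).submatrix b id * A⁻¹ * M.submatrix id a =
      (A⁻¹ * M).submatrix b a := by
    ext l m
    simp [Matrix.mul_apply, Matrix.one_apply]
  rw [Matrix.det_fromBlocks₁₁, Matrix.invOf_eq_nonsing_inv, hsub, zero_sub, Matrix.det_neg]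
  exact mul_ne_zero hA (mul_ne_zero (by simp) h)

namespace MixedGraph

variable {W : Type*}

section Orbit

variable {ι : Type*} [Finite W] [Finite ι] (π : Equiv.Perm (W ⊕ ι))

theorem exists_pow_succ_eq_inr (l : ι) : ∃ n, ∃ m, (π ^ (n + 1)) (Sum.inr l) = Sum.inr m := by
  obtain ⟨n, hn, h⟩ := (isOfFinOrder_of_finite π).exists_pow_eq_one
  exact ⟨n - 1, l, by rw [Nat.sub_add_cancel hn, h, Equiv.Perm.one_apply]⟩

open scoped Classical in
/-- The number of nodes in `W` that the orbit of `l` visits before its first return to `ι`, that is,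
one less than the first return time. -/
noncomputable def firstReturn (l : ι) : ℕ := Nat.find (exists_pow_succ_eq_inr π l)

variable {π} {l m : ι} {j k n : ℕ}

theorem exists_pow_firstReturn_eq_inr (π : Equiv.Perm (W ⊕ ι)) (l : ι) :
    ∃ m, (π ^ (firstReturn π l + 1)) (Sum.inr l) = Sum.inr m := by
  classical exact Nat.find_spec (exists_pow_succ_eq_inr π l)

theorem exists_pow_eq_inl_of_lt_firstReturn (hk : k < firstReturn π l) :
    ∃ w, (π ^ (k + 1)) (Sum.inr l) = Sum.inl w := by
  classical
  rcases h : (π ^ (k + 1)) (Sum.inr l) with w | m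
  · exact ⟨w, rfl⟩
  · exact absurd ⟨m, h⟩ (Nat.find_min (exists_pow_succ_eq_inr π l) hk)

theorem eq_of_pow_eq_pow (hj : j ≤ firstReturn π l) (hk : k ≤ firstReturn π m)
    (h : (π ^ (j + 1)) (Sum.inr l) = (π ^ (k + 1)) (Sum.inr m)) : l = m := by
  wlog hjk : j ≤ k generalizing j k l m
  · exact (this hk hj h.symm (le_of_not_ge hjk)).symm
  obtain ⟨d, rfl⟩ := Nat.exists_eq_add_of_le hjk
  rw [show j + d + 1 = (j + 1) + d by ring, pow_add π (j + 1) d, Equiv.Perm.mul_apply] at h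
  have h' := (π ^ (j + 1)).injective h
  rcases d with _ | d
  · simpa using h'
  · obtain ⟨w, hw⟩ := exists_pow_eq_inl_of_lt_firstReturn (show d < firstReturn π m by omega)
    simp [hw] at h'

variable {H : MixedGraph W} {a b : ι → W}

theorem exists_walk_of_pow_eq_inl (hb : ∀ l, π (Sum.inr l) = Sum.inl (b l))
    (hbi : ∀ w w', π (Sum.inl w) = Sum.inl w' → w = w' ∨ H.bi.Adj w' w)
    (hn : n ≤ firstReturn π l) {v : W} (hv : (π ^ (n + 1)) (Sum.inr l) = Sum.inl v) :
    ∃ p : H.bi.Walk v (b l), ∀ x ∈ p.support, ∃ k ≤ n, (π ^ (k + 1)) (Sum.inr l) = Sum.inl x := by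
  induction n generalizing v with
  | zero =>
    obtain rfl : b l = v := by simpa [hb] using hv
    exact ⟨.nil, fun x hx => ⟨0, le_rfl, by simp_all⟩⟩
  | succ n ih =>
    obtain ⟨u, hu⟩ := exists_pow_eq_inl_of_lt_firstReturn (Nat.lt_of_succ_le hn)
    obtain ⟨p, hp⟩ := ih (by omega) hu
    have hlift : ∀ x ∈ p.support, ∃ k ≤ n + 1, (π ^ (k + 1)) (Sum.inr l) = Sum.inl x :=
      fun x hx => (hp x hx).imp fun k hk => ⟨by omega, hk.2⟩
    have hstep : π (Sum.inl u) = Sum.inl v := by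
      rw [← hu, ← Equiv.Perm.mul_apply, ← pow_succ', hv]
    rcases hbi u v hstep with rfl | hadj
    · exact ⟨p, hlift⟩
    · refine ⟨.cons hadj p, fun x hx => ?_⟩
      rw [SimpleGraph.Walk.support_cons, List.mem_cons] at hx
      rcases hx with rfl | hx
      · exact ⟨n + 1, le_rfl, hv⟩
      · exact hlift x hx

theorem exists_halfColliderPath_of_perm (hb : ∀ l, π (Sum.inr l) = Sum.inl (b l))
    (hbi : ∀ w w', π (Sum.inl w) = Sum.inl w' → w = w' ∨ H.bi.Adj w' w)
    (hdir : ∀ w m, π (Sum.inl w) = Sum.inr m → w = a m ∨ H.dir (a m) w)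
    (hm : (π ^ (firstReturn π l + 1)) (Sum.inr l) = Sum.inr m) :
    ∃ p : H.HalfColliderPath (a m) (b l), ∀ x ∈ p.biPortion,
      ∃ k ≤ firstReturn π l, (π ^ (k + 1)) (Sum.inr l) = Sum.inl x := by
  obtain ⟨n, hn⟩ : ∃ n, firstReturn π l = n + 1 := by
    refine Nat.exists_eq_succ_of_ne_zero fun h => ?_
    simp [h, hb] at hm
  rw [hn] at hm ⊢
  obtain ⟨u, hu⟩ := exists_pow_eq_inl_of_lt_firstReturn (show n < firstReturn π l by omega)
  obtain ⟨p, hp⟩ := exists_walk_of_pow_eq_inl hb hbi (by omega) hu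
  have hlift : ∀ x ∈ p.support, ∃ k ≤ n + 1, (π ^ (k + 1)) (Sum.inr l) = Sum.inl x :=
    fun x hx => (hp x hx).imp fun k hk => ⟨by omega, hk.2⟩
  have hstep : π (Sum.inl u) = Sum.inr m := by
    rw [← hu, ← Equiv.Perm.mul_apply, ← pow_succ', hm]
  rcases hdir u m hstep with rfl | hdir
  · exact ⟨.bidirected p, hlift⟩
  · exact ⟨.directed hdir p, hlift⟩

end Orbit

/-- There is a system of half-collider paths from `Sb` to `Se` with pairwise disjoint bi-directed
portions. -/
def HasDisjointSystem (G : MixedGraph W) (Sb Se : Set W) : Prop :=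
  ∃ P : G.HalfColliderSystem Sb Se,
    Pairwise fun k l => Disjoint (P.path k).biPortion (P.path l).biPortion

theorem hasDisjointSystem_range {ι : Type*} [Finite ι] {H : MixedGraph W} {a b : ι → W}
    (ha : Function.Injective a) (hb : Function.Injective b)
    (p : ∀ l, H.HalfColliderPath (a l) (b l))
    (hp : Pairwise fun k l => Disjoint (p k).biPortion (p l).biPortion) :
    H.HasDisjointSystem (Set.range a) (Set.range b) := by
  have hcard {f : ι → W} (hf : Function.Injective f) : (Set.range f).ncard = Nat.card ι := by
    rw [← Set.image_univ, Set.ncard_image_of_injective _ hf, Set.ncard_univ]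
  let e := (Finite.equivFin ι).symm
  have hsurj (f : ι → W) : ∀ v ∈ Set.range f, ∃ l, f (e l) = v := by
    rintro _ ⟨l, rfl⟩
    exact ⟨e.symm l, by simp⟩
  exact ⟨⟨Nat.card ι, hcard ha, hcard hb, a ∘ e, b ∘ e, fun l => p (e l), fun _ => ⟨_, rfl⟩,
    fun _ => ⟨_, rfl⟩, hsurj a, hsurj b⟩, fun k l hkl => hp (e.injective.ne hkl)⟩

theorem hasDisjointSystem_of_perm {ι : Type*} [Finite W] [Finite ι] {π : Equiv.Perm (W ⊕ ι)}
    {H : MixedGraph W} {a b : ι → W} (ha : Function.Injective a) (hb : Function.Injective b)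
    (hπ : ∀ l, π (Sum.inr l) = Sum.inl (b l))
    (hbi : ∀ w w', π (Sum.inl w) = Sum.inl w' → w = w' ∨ H.bi.Adj w' w)
    (hdir : ∀ w m, π (Sum.inl w) = Sum.inr m → w = a m ∨ H.dir (a m) w) :
    H.HasDisjointSystem (Set.range a) (Set.range b) := by
  choose r hr using exists_pow_firstReturn_eq_inr π
  have hr_inj : Function.Injective r := fun l m h =>
    eq_of_pow_eq_pow le_rfl le_rfl (by rw [hr, hr, h])
  choose p hp using fun l => exists_halfColliderPath_of_perm hπ hbi hdir (hr l)
  rw [← (Finite.surjective_of_injective hr_inj).range_comp a]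
  refine hasDisjointSystem_range (ha.comp hr_inj) hb p fun k l hkl => ?_
  refine Set.disjoint_left.2 fun x hx hx' => ?_
  obtain ⟨j, hj, h⟩ := hp k x hx
  obtain ⟨j', hj', h'⟩ := hp l x hx'
  exact hkl (eq_of_pow_eq_pow hj hj' (h.trans h'.symm))

/-- `B` has the zero pattern required of the elements of `𝐁(G)`. -/
def DirSupported {R : Type*} [Zero R] (G : MixedGraph W) (B : Matrix W W R) : Prop :=
  ∀ i j, ¬ G.dir j i → B i j = 0

/-- `Om` has the zero pattern required of the elements of `𝛀(G)`. -/
def BiSupported {R : Type*} [Zero R] (G : MixedGraph W) (Om : Matrix W W R) : Prop :=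
  ∀ i j, i ≠ j → ¬ G.bi.Adj j i → Om i j = 0

variable [Fintype W] [DecidableEq W] {K : Type*} [Field K] {H : MixedGraph W} {B Om : Matrix W W K}

theorem hasDisjointSystem_of_det_ne_zero {ι : Type*} [Fintype ι] [DecidableEq ι]
    (hB : H.DirSupported B) (hOm : H.BiSupported Om) (hdet : Om.det ≠ 0) {a b : ι → W}
    (ha : Function.Injective a) (hb : Function.Injective b)
    (h : ((Om⁻¹ * (1 - B)).submatrix b a).det ≠ 0) :
    H.HasDisjointSystem (Set.range a) (Set.range b) := by
  obtain ⟨π, hπ⟩ :=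
    exists_perm_forall_apply_ne_zero (det_fromBlocks_submatrix_ne_zero hdet h)
  refine hasDisjointSystem_of_perm (π := π) ha hb (fun l => ?_) (fun w w' hw => ?_) fun w m hw => ?_
  · have := hπ (Sum.inr l)
    rcases hl : π (Sum.inr l) with w | m
    · rw [hl, Matrix.fromBlocks_apply₂₁] at this
      by_contra hne
      exact this (Matrix.one_apply_ne fun h => hne (by simp [h]))
    · simp [hl] at this
  · have := hπ (Sum.inl w)
    rw [hw, Matrix.fromBlocks_apply₁₁] at this
    by_contra! hne
    exact this (hOm w w' hne.1 hne.2)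
  · have := hπ (Sum.inl w)
    rw [hw, Matrix.fromBlocks_apply₁₂] at this
    by_contra! hne
    exact this (by simp [Matrix.one_apply_ne hne.1, hB _ _ hne.2])

theorem exists_hasDisjointSystem_of_linearIndependent (hB : H.DirSupported B)
    (hOm : H.BiSupported Om) (hdet : Om.det ≠ 0) {C D : Set W}
    (h : LinearIndependent K ((Om⁻¹ * (1 - B)).submatrix ((↑) : D → W) ((↑) : C → W)).row) :
    ∃ Sb ⊆ C, H.HasDisjointSystem Sb D := by
  classical
  obtain ⟨a, ha, hne⟩ := exists_injective_det_submatrix_ne_zero h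
  have hsys := hasDisjointSystem_of_det_ne_zero hB hOm hdet (Subtype.val_injective.comp ha)
    Subtype.val_injective hne
  rw [Subtype.range_val] at hsys
  exact ⟨_, Set.range_subset_iff.2 fun l => (a l).2, hsys⟩

end MixedGraph

/-! ### From systems of half-collider paths to minors -/

section Neumann

attribute [local instance] Matrix.linftyOpNormedRing Matrix.linftyOpNormedAlgebra

theorem exists_hasSum_inv_one_sub_smul {n : Type*} [Fintype n] [DecidableEq n] (A : Matrix n n ℝ) :
    ∃ t : ℝ, 0 < t ∧ (1 - t • A).det ≠ 0 ∧
      ∀ u v, HasSum (fun k => t ^ k * (A ^ k) u v) ((1 - t • A)⁻¹ u v) := by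
  refine ⟨(‖A‖ + 1)⁻¹, by positivity, ?_⟩
  set t := (‖A‖ + 1)⁻¹ with ht
  have hlt : ‖t • A‖ < 1 := by
    rw [norm_smul, ht, Real.norm_of_nonneg (by positivity), inv_mul_lt_one₀ (by positivity)]
    linarith
  have hmul := geom_series_mul_neg (t • A) hlt
  refine ⟨(Matrix.isUnit_det_of_left_inverse hmul).ne_zero, fun u v => ?_⟩
  rw [Matrix.inv_eq_left_inv hmul]
  have hsum := (summable_geometric_of_norm_lt_one hlt).hasSum
  simpa only [smul_pow, Matrix.smul_apply, smul_eq_mul] using Pi.hasSum.1 (Pi.hasSum.1 hsum u) v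

end Neumann

open scoped Classical in
theorem exists_mul_apply_eq_ite {ι l n R : Type*} [Fintype n] [NonAssocSemiring R] (d : ι → n)
    {f : ι → n} (hf : Function.Injective f) :
    ∃ N : Matrix n n R, (∀ u v, N u v ≠ 0 → ∃ m, d m = u ∧ f m = v ∧ u ≠ v) ∧
      ∀ (A : Matrix l n R) a m, (A * N) a (f m) = if d m = f m then 0 else A a (d m) := by
  refine ⟨Matrix.of fun u v => if ∃ m, d m = u ∧ f m = v ∧ u ≠ v then 1 else 0,
    fun u v huv => ?_, fun A a m => ?_⟩
  · by_contra h
    exact huv (if_neg h)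
  · have hiff u : (∃ m', d m' = u ∧ f m' = f m ∧ u ≠ f m) ↔ u = d m ∧ d m ≠ f m := by
      constructor
      · rintro ⟨m', rfl, h, hne⟩
        rw [← hf h]
        exact ⟨rfl, (hf h).symm ▸ hne⟩
      · rintro ⟨rfl, hne⟩
        exact ⟨m, rfl, rfl, hne⟩
    simp only [Matrix.mul_apply, Matrix.of_apply, hiff, mul_ite, mul_one, mul_zero, ite_and,
      Finset.sum_ite_eq', Finset.mem_univ, if_true, ite_not]

theorem exists_det_add_smul_diagonal_ne_zero {n : Type*} [Fintype n] [DecidableEq n]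
    (A : Matrix n n ℝ) (p : n → ℝ)
    (hA : ∀ m, p m = 0 → A m m ≠ 0 ∧ ∀ l, l ≠ m → A l m = 0) :
    ∃ c : ℝ, (A + c • Matrix.diagonal p).det ≠ 0 := by
  have hdom (m : n) : ∀ᶠ c in Filter.atTop,
      ∑ l ∈ Finset.univ.erase m, ‖A l m‖ < ‖A m m + c * p m‖ := by
    by_cases hp : p m = 0
    · rw [Finset.sum_eq_zero fun l hl => by
        rw [(hA m hp).2 l (Finset.ne_of_mem_erase hl), norm_zero]]
      simp [hp, (hA m hp).1]
    · have hlin : Filter.Tendsto (fun c => |c * p m|) Filter.atTop Filter.atTop := by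
        simp only [abs_mul]
        exact Filter.tendsto_abs_atTop_atTop.atTop_mul_const (abs_pos.2 hp)
      filter_upwards [hlin.eventually_gt_atTop (∑ l ∈ Finset.univ.erase m, ‖A l m‖ + |A m m|)]
        with c hc
      have := abs_sub_abs_le_abs_sub (c * p m) (-A m m)
      rw [abs_neg, sub_neg_eq_add, add_comm (c * p m)] at this
      rw [Real.norm_eq_abs]
      linarith
  obtain ⟨c, hc⟩ := (Filter.eventually_all.2 hdom).exists
  refine ⟨c, det_ne_zero_of_sum_col_lt_diag fun m => ?_⟩
  convert hc m using 1
  · refine Finset.sum_congr rfl fun l hl => ?_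
    simp [Matrix.diagonal_apply_ne _ (Finset.ne_of_mem_erase hl)]
  · simp

theorem linearIndependent_row_of_submatrix {k l m n R : Type*} [Semiring R] {M : Matrix m n R}
    (e : l ≃ m) (f : k → n) (h : LinearIndependent R (M.submatrix e f).row) :
    LinearIndependent R M.row :=
  (linearIndependent_equiv e).1 (LinearIndependent.of_comp (LinearMap.funLeft R R f) h)

namespace MixedGraph

variable {W : Type*} {H : MixedGraph W}

section Chain

variable {ι : Type*}

open scoped Classical in
/-- The adjacency matrix of the bi-directed edges that have both ends in the same one of the sets
`S l`. Its powers count the bi-directed walks that stay in one of these sets. -/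
noncomputable def chainMatrix (H : MixedGraph W) (S : ι → Set W) : Matrix W W ℝ :=
  Matrix.of fun u v => if ∃ l, u ∈ S l ∧ v ∈ S l ∧ H.bi.Adj u v then 1 else 0

theorem chainMatrix_nonneg (H : MixedGraph W) (S : ι → Set W) (u v : W) :
    0 ≤ H.chainMatrix S u v := by
  simp only [chainMatrix, Matrix.of_apply]
  split_ifs <;> norm_num

open scoped Classical in
theorem chainMatrix_isSymm (H : MixedGraph W) (S : ι → Set W) : (H.chainMatrix S).IsSymm :=
  Matrix.IsSymm.ext fun _ _ =>
    if_congr (exists_congr fun _ => by rw [H.bi.adj_comm, and_left_comm]) rfl rfl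

variable [Fintype W] [DecidableEq W] {S : ι → Set W}

theorem chainMatrix_pow_nonneg (H : MixedGraph W) (S : ι → Set W) (n : ℕ) (u v : W) :
    0 ≤ (H.chainMatrix S ^ n) u v := by
  induction n generalizing u v with
  | zero => rw [pow_zero, Matrix.one_apply]; split_ifs <;> norm_num
  | succ n ih =>
    rw [pow_succ, Matrix.mul_apply]
    exact Finset.sum_nonneg fun w _ => mul_nonneg (ih u w) (H.chainMatrix_nonneg S w v)

theorem mem_of_chainMatrix_pow_ne_zero (hS : Pairwise fun k l => Disjoint (S k) (S l)) {l : ι}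
    {u v : W} (hu : u ∈ S l) (n : ℕ) (h : (H.chainMatrix S ^ n) u v ≠ 0) : v ∈ S l := by
  induction n generalizing v with
  | zero =>
    by_contra hv
    exact h (Matrix.one_apply_ne fun huv => hv (huv ▸ hu))
  | succ n ih =>
    rw [pow_succ, Matrix.mul_apply] at h
    obtain ⟨w, -, hw⟩ := Finset.exists_ne_zero_of_sum_ne_zero h
    have hwl := ih (left_ne_zero_of_mul hw)
    have hwv := right_ne_zero_of_mul hw
    simp only [chainMatrix, Matrix.of_apply, ne_eq, ite_eq_right_iff, one_ne_zero, imp_false,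
      not_not] at hwv
    obtain ⟨k, hk, hvk, -⟩ := hwv
    obtain rfl : k = l := by
      by_contra hkl
      exact Set.disjoint_left.1 (hS hkl) hk hwl
    exact hvk

theorem exists_chainMatrix_pow_pos {l : ι} {a b : W} (w : H.bi.Walk a b)
    (hw : ∀ x ∈ w.support, x ∈ S l) : ∃ n, 0 < (H.chainMatrix S ^ n) b a := by
  induction w with
  | nil => exact ⟨0, by simp⟩
  | @cons u v b h p ih =>
    obtain ⟨n, hn⟩ := ih fun x hx => hw x (by simp [hx])
    have hvu : H.chainMatrix S v u = 1 :=
      if_pos ⟨l, hw _ (by simp), hw _ (by simp), h.symm⟩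
    refine ⟨n + 1, ?_⟩
    rw [pow_succ, Matrix.mul_apply]
    exact Finset.sum_pos' (fun w _ => mul_nonneg (H.chainMatrix_pow_nonneg S n _ _)
      (H.chainMatrix_nonneg S _ _)) ⟨v, Finset.mem_univ v, by rwa [hvu, mul_one]⟩

theorem exists_biSupported_inv_pos (H : MixedGraph W)
    (hS : Pairwise fun k l => Disjoint (S k) (S l)) :
    ∃ Om : Matrix W W ℝ, Om.IsSymm ∧ H.BiSupported Om ∧ Om.det ≠ 0 ∧
      (∀ l u v (w : H.bi.Walk u v), (∀ x ∈ w.support, x ∈ S l) → 0 < Om⁻¹ v u) ∧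
      ∀ k l, k ≠ l → ∀ u ∈ S k, ∀ v ∈ S l, Om⁻¹ u v = 0 := by
  obtain ⟨t, ht, hdet, hsum⟩ := exists_hasSum_inv_one_sub_smul (H.chainMatrix S)
  refine ⟨1 - t • H.chainMatrix S, Matrix.isSymm_one.sub ((H.chainMatrix_isSymm S).smul t),
    fun u v huv hadj => ?_, hdet, fun l u v w hw => ?_, fun k l hkl u hu v hv => ?_⟩
  · have : H.chainMatrix S u v = 0 := if_neg fun ⟨_, _, _, h⟩ => hadj h.symm
    simp [this, huv]
  · obtain ⟨n, hn⟩ := exists_chainMatrix_pow_pos w hw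
    exact (mul_pos (pow_pos ht n) hn).trans_le (le_hasSum (hsum v u) n fun k _ =>
      mul_nonneg (pow_pos ht k).le (H.chainMatrix_pow_nonneg S k _ _))
  · refine (hsum u v).unique ?_
    convert hasSum_zero with n
    refine mul_eq_zero_of_right _ ?_
    by_contra hne
    exact Set.disjoint_left.1 (hS hkl) (mem_of_chainMatrix_pow_ne_zero hS hu n hne) hv

end Chain

theorem HalfColliderPath.exists_walk {a b : W} (p : H.HalfColliderPath a b) :
    ∃ c, (c ≠ a → H.dir a c) ∧ ∃ w : H.bi.Walk c b, ∀ x ∈ w.support, x ∈ p.biPortion := by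
  cases p with
  | bidirected w => exact ⟨_, fun h => absurd rfl h, w, fun _ hx => hx⟩
  | directed h w => exact ⟨_, fun _ => h, w, fun _ hx => hx⟩

namespace HalfColliderSystem

variable {Sb Se : Set W} (P : H.HalfColliderSystem Sb Se)

theorem injective_of_surj {s : ℕ} {S : Set W} (hS : S.ncard = s) {f : Fin s → W}
    (hf : ∀ v ∈ S, ∃ l, f l = v) : Function.Injective f := by
  have hle : s ≤ (Set.range f).ncard := hS.ge.trans (Set.ncard_le_ncard hf)
  have hcard : (f '' Set.univ).ncard = (Set.univ : Set (Fin s)).ncard :=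
    le_antisymm Set.ncard_image_le (by rwa [Set.image_univ, Set.ncard_univ, Nat.card_fin])
  exact Set.injOn_univ.1 (Set.injOn_of_ncard_image_eq hcard)

theorem first_injective : Function.Injective P.first :=
  injective_of_surj P.card_begin P.first_surj

theorem last_injective : Function.Injective P.last :=
  injective_of_surj P.card_end P.last_surj

theorem exists_det_submatrix_ne_zero [Fintype W] [DecidableEq W]
    (hP : Pairwise fun k l => Disjoint (P.path k).biPortion (P.path l).biPortion) :
    ∃ B Om : Matrix W W ℝ, H.DirSupported B ∧ Om.IsSymm ∧ H.BiSupported Om ∧ Om.det ≠ 0 ∧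
      ((Om⁻¹ * (1 - B)).submatrix P.last P.first).det ≠ 0 := by
  classical
  choose d hd w hw using fun l => (P.path l).exists_walk
  obtain ⟨Om, hsymm, hsupp, hdet, hpos, hzero⟩ := H.exists_biSupported_inv_pos hP
  obtain ⟨N, hN, hmul⟩ := exists_mul_apply_eq_ite (R := ℝ) (l := W) d P.first_injective
  have hoff {l m} (hlm : l ≠ m) : Om⁻¹ (P.last l) (d m) = 0 :=
    hzero l m hlm _ (hw l _ (w l).end_mem_support) _ (hw m _ (w m).start_mem_support)
  have hdiag m : Om⁻¹ (P.last m) (d m) ≠ 0 := (hpos m _ _ (w m) (hw m)).ne'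
  obtain ⟨c, hc⟩ := exists_det_add_smul_diagonal_ne_zero (Om⁻¹.submatrix P.last P.first)
    (fun m => if d m = P.first m then 0 else Om⁻¹ (P.last m) (d m)) fun m hm => by
      have hm : d m = P.first m := by
        by_contra h
        exact hdiag m (by rwa [if_neg h] at hm)
      exact ⟨by simpa [hm] using hdiag m, fun l hl => by simpa [hm] using hoff hl⟩
  refine ⟨-c • N, Om, fun u v huv => ?_, hsymm, hsupp, hdet, ?_⟩
  · by_contra hne
    obtain ⟨m, rfl, rfl, h⟩ := hN u v (right_ne_zero_of_mul hne)
    exact huv (hd m h)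
  · convert hc using 2
    ext l m
    rw [neg_smul, sub_neg_eq_add, mul_add, mul_one, Matrix.mul_smul]
    rcases eq_or_ne l m with rfl | hlm
    · simp [hmul]
    · simp [hmul, hoff hlm, hlm]

end HalfColliderSystem

theorem HasDisjointSystem.exists_linearIndependent [Fintype W] [DecidableEq W] {Sb C D : Set W}
    (h : H.HasDisjointSystem Sb D) (hSb : Sb ⊆ C) :
    ∃ B Om : Matrix W W ℝ, H.DirSupported B ∧ Om.IsSymm ∧ H.BiSupported Om ∧ Om.det ≠ 0 ∧
      LinearIndependent ℝ ((Om⁻¹ * (1 - B)).submatrix ((↑) : D → W) ((↑) : C → W)).row := by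
  obtain ⟨P, hP⟩ := h
  obtain ⟨B, Om, hB, hsymm, hOm, hdet, hne⟩ := P.exists_det_submatrix_ne_zero hP
  let e : Fin P.s ≃ D := Equiv.ofBijective (fun l => ⟨P.last l, P.last_mem l⟩)
    ⟨fun l m hlm => P.last_injective (congrArg Subtype.val hlm),
      fun v => (P.last_surj v v.2).imp fun _ => Subtype.ext⟩
  let f : Fin P.s → C := fun l => ⟨P.first l, hSb (P.first_mem l)⟩
  exact ⟨B, Om, hB, hsymm, hOm, hdet,
    linearIndependent_row_of_submatrix e f (Matrix.linearIndependent_rows_of_det_ne_zero hne)⟩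

end MixedGraph

/-! ### Matrices with a prescribed row and column -/

section Bordered

variable {V R : Type*} [DecidableEq V]

/-- The matrix `Om` with the off-diagonal entries of its `i`-th row and column replaced by those of
`w`, and the diagonal entry at `i` by `d`. -/
def bordered (Om : Matrix V V R) (i : V) (w : V → R) (d : R) : Matrix V V R :=
  Matrix.of fun a b => if a = i then (if b = i then d else w b) else if b = i then w a else Om a b

theorem bordered_apply (Om : Matrix V V R) (i : V) (w : V → R) (d : R) (a b : V) :
    bordered Om i w d a b =
      if a = i then (if b = i then d else w b) else if b = i then w a else Om a b :=
  rfl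

theorem bordered_apply_self (Om : Matrix V V R) (i : V) (w : V → R) (d : R) :
    bordered Om i w d i i = d := by
  simp [bordered]

theorem bordered_isSymm {Om : Matrix V V R} (h : Om.IsSymm) (i : V) (w : V → R) (d : R) :
    (bordered Om i w d).IsSymm := by
  refine Matrix.IsSymm.ext fun a b => ?_
  simp only [bordered, Matrix.of_apply]
  split_ifs <;> simp_all [h.apply]

theorem bordered_zero_apply_of_ne [Zero R] (Om : Matrix V V R) {i a : V} (ha : a ≠ i) (d : R) :
    bordered Om i 0 d a i = 0 := by
  simp [bordered, ha]

theorem bordered_bordered (Om : Matrix V V R) (i : V) (w w' : V → R) (d d' : R) :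
    bordered (bordered Om i w d) i w' d' = bordered Om i w' d' := by
  ext a b
  by_cases ha : a = i <;> by_cases hb : b = i <;> simp [bordered, ha, hb]

theorem bordered_one [Zero R] [One R] (i : V) : bordered (1 : Matrix V V R) i 0 1 = 1 := by
  ext a b
  by_cases ha : a = i <;> by_cases hb : b = i <;>
    simp [bordered, Matrix.one_apply, ha, hb, eq_comm (a := i)]

theorem bordered_submatrix_compl (Om : Matrix V V R) (i : V) (w : V → R) (d : R) :
    (bordered Om i w d).submatrix ((↑) : ({i}ᶜ : Set V) → V) ((↑) : ({i}ᶜ : Set V) → V) =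
      Om.submatrix ((↑) : ({i}ᶜ : Set V) → V) ((↑) : ({i}ᶜ : Set V) → V) := by
  ext ⟨a, ha : a ≠ i⟩ ⟨b, hb : b ≠ i⟩
  simp [bordered, ha, hb]

variable [CommRing R]

theorem bordered_zero_eq_updateRow (Om : Matrix V V R) (i : V) (d : R) :
    bordered Om i 0 d = (bordered Om i 0 1).updateRow i (d • Pi.single i 1) := by
  ext a b
  by_cases ha : a = i
  · subst ha
    simp [bordered, Pi.single_apply]
  · simp [bordered, ha]

variable [Fintype V]

theorem det_bordered_zero (Om : Matrix V V R) (i : V) (d : R) :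
    (bordered Om i 0 d).det = d * (bordered Om i 0 1).det := by
  have h := bordered_zero_eq_updateRow Om i 1
  rw [one_smul] at h
  rw [bordered_zero_eq_updateRow, Matrix.det_updateRow_smul, ← h]

theorem bordered_zero_mulVec_single (Om : Matrix V V R) (i : V) (d : R) :
    bordered Om i 0 d *ᵥ Pi.single i 1 = d • Pi.single i 1 := by
  ext a
  by_cases ha : a = i <;> simp [bordered, ha]

theorem vecMul_bordered_zero_apply_self (Om : Matrix V V R) (i : V) (w : V → R) (d : R) :
    (w ᵥ* bordered Om i 0 d) i = w i * d := by
  simp [Matrix.vecMul, dotProduct, bordered]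

theorem vecMul_bordered_zero_of_apply_eq_zero (Om : Matrix V V R) {i : V} {u : V → R} (hu : u i = 0)
    (c d : R) : u ᵥ* bordered Om i 0 c = u ᵥ* bordered Om i 0 d := by
  ext b
  refine Finset.sum_congr rfl fun a _ => ?_
  by_cases ha : a = i
  · rw [ha, hu, zero_mul, zero_mul]
  · by_cases hb : b = i <;> simp [bordered, ha, hb]

theorem bordered_zero_mul_bordered_zero {A : Matrix V V R} {i : V} (hA : ∀ a, a ≠ i → A a i = 0)
    (B : Matrix V V R) (c d : R) :
    bordered A i 0 c * bordered B i 0 d = bordered (A * B) i 0 (c * d) := by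
  ext a b
  by_cases ha : a = i
  · rw [Matrix.mul_apply, Finset.sum_eq_single i (by simp +contextual [bordered, ha]) (by simp)]
    by_cases hb : b = i <;> simp [bordered, ha, hb]
  · by_cases hb : b = i
    · simp [Matrix.mul_apply, bordered, ha, hb]
    · simp only [bordered, Matrix.mul_apply, Matrix.of_apply, if_neg ha, if_neg hb]
      refine Finset.sum_congr rfl fun k _ => ?_
      by_cases hk : k = i <;> simp [hk, hA a ha]

theorem inv_bordered_zero {K : Type*} [Field K] {Om : Matrix V V K} {i : V}
    (hdet : (bordered Om i 0 1).det ≠ 0) {d : K} (hd : d ≠ 0) :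
    (bordered Om i 0 d)⁻¹ = bordered (bordered Om i 0 1)⁻¹ i 0 d⁻¹ := by
  refine Matrix.inv_eq_right_inv ?_
  rw [← bordered_bordered Om i 0 0 1 d,
    bordered_zero_mul_bordered_zero (fun a ha => bordered_zero_apply_of_ne Om ha 1),
    Matrix.mul_nonsing_inv _ hdet.isUnit, mul_inv_cancel₀ hd, bordered_one]

theorem bordered_zero_eq_add (A : Matrix V V R) (i : V) (d : R) :
    bordered A i 0 d =
      Matrix.diagonal (Function.update 1 i 0) * A * Matrix.diagonal (Function.update 1 i 0) +
        d • Matrix.vecMulVec (Pi.single i 1) (Pi.single i 1) := by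
  ext a b
  by_cases ha : a = i <;> by_cases hb : b = i <;>
    simp [bordered, Matrix.vecMulVec_apply, ha, hb]

theorem diagonal_update_one_mul {n : Type*} (i : V) (M : Matrix V n R) :
    (Matrix.diagonal (Function.update 1 i 0) : Matrix V V R) * M = M.updateRow i 0 := by
  ext a b
  by_cases ha : a = i
  · subst ha; simp [Matrix.diagonal_mul]
  · simp [Matrix.diagonal_mul, ha]

theorem transpose_mul_bordered_zero_mul {n : Type*} (A : Matrix V V R) (i : V) (d : R)
    (M : Matrix V n R) : Mᵀ * bordered A i 0 d * M =
      (M.updateRow i 0)ᵀ * A * M.updateRow i 0 + d • Matrix.vecMulVec (M i) (M i) := by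
  have hrow : Pi.single i 1 ᵥ* M = M i := Matrix.single_one_vecMul i M
  rw [bordered_zero_eq_add, ← diagonal_update_one_mul, Matrix.transpose_mul,
    Matrix.diagonal_transpose, Matrix.mul_add, Matrix.add_mul, Matrix.mul_smul, Matrix.smul_mul,
    Matrix.mul_vecMulVec, Matrix.vecMulVec_mul, Matrix.mulVec_transpose, hrow]
  simp only [Matrix.mul_assoc]

end Bordered

theorem posDef_bordered_zero {V : Type*} [Finite V] [DecidableEq V] {Om : Matrix V V ℝ}
    (h : Om.PosDef) (i : V) {d : ℝ} (hd : 0 < d) : (bordered Om i 0 d).PosDef := by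
  have := Fintype.ofFinite V
  have hsymm : Om.IsSymm := by simpa using h.isHermitian
  refine .of_dotProduct_mulVec_pos (by simpa using bordered_isSymm hsymm i 0 d) fun x hx => ?_
  have hsplit : star x ⬝ᵥ (bordered Om i 0 d *ᵥ x) =
      star (Function.update x i 0) ⬝ᵥ (Om *ᵥ Function.update x i 0) + d * x i ^ 2 := by
    have hdiag : Matrix.diagonal (Function.update 1 i 0) *ᵥ x = Function.update x i 0 := by
      ext a
      by_cases ha : a = i
      · subst ha; simp [Matrix.mulVec_diagonal]
      · simp [Matrix.mulVec_diagonal, ha]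
    have hdiag' : x ᵥ* Matrix.diagonal (Function.update 1 i 0) = Function.update x i 0 := by
      rw [← Matrix.mulVec_transpose, Matrix.diagonal_transpose, hdiag]
    rw [bordered_zero_eq_add, Matrix.add_mulVec, dotProduct_add, star_trivial, star_trivial,
      ← Matrix.mulVec_mulVec, ← Matrix.mulVec_mulVec, hdiag, Matrix.dotProduct_mulVec, hdiag',
      Matrix.smul_mulVec, Matrix.vecMulVec_mulVec]
    simp [sq]
  rw [hsplit]
  by_cases hxi : x i = 0
  · rw [← hxi, Function.update_eq_self, hxi]
    simpa using h.dotProduct_mulVec_pos hx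
  · have hnonneg := h.posSemidef.dotProduct_mulVec_nonneg (Function.update x i 0)
    have : 0 < d * x i ^ 2 := by positivity
    linarith

section RowShear

variable {V R : Type*} [Fintype V] [DecidableEq V] [CommRing R]

/-- The elementary matrix whose left multiplication adds to the `i`-th row of a matrix the
combination of its rows with coefficients `u`. -/
def rowShear (i : V) (u : V → R) : Matrix V V R := 1 + Matrix.vecMulVec (Pi.single i 1) u

theorem rowShear_mul {n : Type*} (i : V) (u : V → R) (M : Matrix V n R) :
    rowShear i u * M = M.updateRow i (M i + u ᵥ* M) := by
  rw [rowShear, Matrix.add_mul, Matrix.one_mul, Matrix.vecMulVec_mul]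
  ext a b
  by_cases ha : a = i
  · subst ha; simp [Matrix.vecMulVec_apply]
  · simp [Matrix.vecMulVec_apply, ha]

variable {i : V} {u : V → R}

theorem rowShear_mul_rowShear_neg (hu : u i = 0) : rowShear i u * rowShear i (-u) = 1 := by
  rw [rowShear_mul, rowShear, Matrix.vecMul_add, Matrix.vecMul_vecMulVec]
  ext a b
  by_cases ha : a = i
  · subst ha; simp [Matrix.vecMulVec_apply, hu]
  · simp [Matrix.vecMulVec_apply, ha]

theorem inv_rowShear (hu : u i = 0) : (rowShear i u)⁻¹ = rowShear i (-u) :=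
  Matrix.inv_eq_right_inv (rowShear_mul_rowShear_neg hu)

theorem det_rowShear (hu : u i = 0) : (rowShear i u).det = 1 := by
  rw [rowShear, Matrix.vecMulVec_eq Unit, Matrix.det_one_add_replicateCol_mul_replicateRow]
  simp [hu]

theorem rowShear_mul_bordered_mul_transpose {Om : Matrix V V R} (hOm : Om.IsSymm) (hu : u i = 0)
    (d : R) : rowShear i u * bordered Om i 0 d * (rowShear i u)ᵀ =
      bordered Om i (u ᵥ* bordered Om i 0 1) (d + u ⬝ᵥ u ᵥ* bordered Om i 0 1) := by
  have hleft := vecMul_bordered_zero_of_apply_eq_zero Om hu d 1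
  have hright : bordered Om i 0 d *ᵥ u = u ᵥ* bordered Om i 0 1 := by
    rw [← Matrix.vecMul_transpose, (bordered_isSymm hOm i 0 d).eq, hleft]
  have hself := vecMul_bordered_zero_apply_self Om i u 1
  rw [hu, zero_mul] at hself
  rw [rowShear, Matrix.transpose_add, Matrix.transpose_one, Matrix.transpose_vecMulVec,
    Matrix.mul_add, Matrix.mul_one, Matrix.mul_vecMulVec, Matrix.add_mul, Matrix.one_mul,
    Matrix.vecMulVec_mul, hleft, Matrix.add_mulVec, hright, Matrix.vecMulVec_mulVec,
    dotProduct_comm (u ᵥ* _)]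
  ext a b
  by_cases ha : a = i <;> by_cases hb : b = i <;>
    simp [bordered_apply, Matrix.vecMulVec_apply, ha, hb, hself]

end RowShear

section DeleteIndex

variable {V : Type*} [Fintype V] [DecidableEq V] {i : V}

theorem submatrix_mul_of_apply_eq_zero {R n o : Type*} [NonUnitalNonAssocSemiring R]
    {X : Matrix V V R} (hX : ∀ a, a ≠ i → X a i = 0) (M : Matrix V n R) (f : o → n) :
    (X * M).submatrix ((↑) : ({i}ᶜ : Set V) → V) f =
      X.submatrix ((↑) : ({i}ᶜ : Set V) → V) ((↑) : ({i}ᶜ : Set V) → V) *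
        M.submatrix ((↑) : ({i}ᶜ : Set V) → V) f := by
  ext a b
  simp only [Matrix.submatrix_apply, Matrix.mul_apply]
  rw [← Finset.sum_erase Finset.univ (a := i) (by rw [hX a a.2, zero_mul])]
  exact Finset.sum_subtype _ (by simp) _

variable {R : Type*} [CommRing R]

theorem det_submatrix_compl (Om : Matrix V V R) (i : V) :
    (Om.submatrix ((↑) : ({i}ᶜ : Set V) → V) ((↑) : ({i}ᶜ : Set V) → V)).det =
      (bordered Om i 0 1).det := by
  have hblock : ∀ a, a ∈ ({i}ᶜ : Set V) → ∀ b, b ∉ ({i}ᶜ : Set V) → bordered Om i 0 1 a b = 0 := by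
    intro a ha b hb
    obtain rfl : b = i := by simpa using hb
    exact bordered_zero_apply_of_ne Om ha 1
  have hone : Matrix.toSquareBlockProp (bordered Om i 0 1) (· ∉ ({i}ᶜ : Set V)) = 1 := by
    ext ⟨a, ha⟩ ⟨b, hb⟩
    obtain rfl : a = i := by simpa using ha
    obtain rfl : b = a := by simpa using hb
    simp [Matrix.toSquareBlockProp, bordered]
  rw [Matrix.twoBlockTriangular_det' _ (· ∈ ({i}ᶜ : Set V)) hblock, hone, Matrix.det_one, mul_one,
    ← bordered_submatrix_compl Om i 0 1]
  rfl

theorem submatrix_inv_bordered_mul {n o : Type*} {Om : Matrix V V R}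
    (hdet : IsUnit (bordered Om i 0 1).det) (M : Matrix V n R) (f : o → n) :
    ((bordered Om i 0 1)⁻¹ * M).submatrix ((↑) : ({i}ᶜ : Set V) → V) f =
      (Om.submatrix ((↑) : ({i}ᶜ : Set V) → V) ((↑) : ({i}ᶜ : Set V) → V))⁻¹ *
        M.submatrix ((↑) : ({i}ᶜ : Set V) → V) f := by
  have hmul := submatrix_mul_of_apply_eq_zero (i := i)
    (fun a ha => bordered_zero_apply_of_ne Om ha (1 : R)) ((bordered Om i 0 1)⁻¹ * M) f
  rw [Matrix.mul_nonsing_inv_cancel_left _ _ hdet, bordered_submatrix_compl] at hmul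
  rw [hmul, Matrix.nonsing_inv_mul_cancel_left _ _ (by rwa [det_submatrix_compl])]

end DeleteIndex

/-! ### The objective function of a block update -/

section BlockObjective

variable {κ : Type*} [Fintype κ]

/-- The Gaussian log-likelihood function in the coordinates of a block update, up to an additive
constant: `v` collects the coefficients of a regression with Gram matrix `A` and `ν` observations,
`η` is the conditional variance, and `c ⬝ᵥ v` is the determinant of the updated `1 - B`. -/
noncomputable def blockObjective (ν : ℝ) (A : Matrix κ κ ℝ) (c v : κ → ℝ) (η : ℝ) : ℝ :=
  Real.log ((c ⬝ᵥ v) ^ 2 / η) - (v ⬝ᵥ A *ᵥ v) / (ν * η)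

/-- The coordinates `(v, η)` that correspond to a feasible pair of a block update: the coefficient
`v o` of the updated node is normalized, and the updated `1 - B` is invertible. -/
structure IsBlockCoord (o : κ) (c v : κ → ℝ) (η : ℝ) : Prop where
  apply_self : v o = 1
  pos : 0 < η
  dotProduct_ne_zero : c ⬝ᵥ v ≠ 0

theorem dotProduct_mulVec_eq_add {K : Type*} [Field K] {A : Matrix κ κ K} (hA : A.IsSymm)
    {c u : κ → K} (hu : A *ᵥ u = c) (hk : c ⬝ᵥ u ≠ 0) (v : κ → K) :
    v ⬝ᵥ A *ᵥ v = (c ⬝ᵥ v) ^ 2 / (c ⬝ᵥ u) +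
      (v - (c ⬝ᵥ v / c ⬝ᵥ u) • u) ⬝ᵥ A *ᵥ (v - (c ⬝ᵥ v / c ⬝ᵥ u) • u) := by
  have huv : u ⬝ᵥ A *ᵥ v = c ⬝ᵥ v := by
    rw [Matrix.dotProduct_mulVec, ← Matrix.mulVec_transpose, hA.eq, hu]
  rw [Matrix.mulVec_sub, Matrix.mulVec_smul, hu, sub_dotProduct, dotProduct_sub, dotProduct_sub,
    smul_dotProduct, smul_dotProduct, dotProduct_smul, dotProduct_smul, huv, dotProduct_comm v c,
    dotProduct_comm u c]
  simp only [smul_eq_mul]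
  field_simp
  ring

section Maximum

variable {ν η : ℝ} {A : Matrix κ κ ℝ} {c u v : κ → ℝ}

theorem blockObjective_eq_add (hν : 0 < ν) (hA : A.IsSymm) (hu : A *ᵥ u = c) (hk : 0 < c ⬝ᵥ u)
    (hη : 0 < η) (hv : c ⬝ᵥ v ≠ 0) : blockObjective ν A c v η = Real.log (ν * (c ⬝ᵥ u)) +
      (Real.log ((c ⬝ᵥ v) ^ 2 / (ν * (c ⬝ᵥ u) * η)) - (c ⬝ᵥ v) ^ 2 / (ν * (c ⬝ᵥ u) * η)) -
      ((v - (c ⬝ᵥ v / c ⬝ᵥ u) • u) ⬝ᵥ A *ᵥ (v - (c ⬝ᵥ v / c ⬝ᵥ u) • u)) / (ν * η) := by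
  have hlog : Real.log ((c ⬝ᵥ v) ^ 2 / η) =
      Real.log (ν * (c ⬝ᵥ u)) + Real.log ((c ⬝ᵥ v) ^ 2 / (ν * (c ⬝ᵥ u) * η)) := by
    rw [← Real.log_mul (by positivity) (by positivity)]
    congr 1
    field_simp
  rw [blockObjective, hlog, dotProduct_mulVec_eq_add hA hu hk.ne', add_div, div_div]
  ring_nf

theorem blockObjective_le (hν : 0 < ν) (hA : A.PosDef) (hu : A *ᵥ u = c) (hk : 0 < c ⬝ᵥ u)
    (hη : 0 < η) (hv : c ⬝ᵥ v ≠ 0) :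
    blockObjective ν A c v η ≤ Real.log (ν * (c ⬝ᵥ u)) - 1 := by
  have hx : 0 < (c ⬝ᵥ v) ^ 2 / (ν * (c ⬝ᵥ u) * η) := by positivity
  have hres := hA.posSemidef.dotProduct_mulVec_nonneg (v - (c ⬝ᵥ v / c ⬝ᵥ u) • u)
  rw [star_trivial] at hres
  rw [blockObjective_eq_add hν (by simpa using hA.isHermitian) hu hk hη hv]
  linarith [Real.log_le_sub_one_of_pos hx, div_nonneg hres (by positivity : 0 ≤ ν * η)]

theorem eq_smul_of_le_blockObjective (hν : 0 < ν) (hA : A.PosDef) (hu : A *ᵥ u = c)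
    (hk : 0 < c ⬝ᵥ u) (hη : 0 < η) (hv : c ⬝ᵥ v ≠ 0)
    (h : Real.log (ν * (c ⬝ᵥ u)) - 1 ≤ blockObjective ν A c v η) :
    v = (c ⬝ᵥ v / c ⬝ᵥ u) • u ∧ η = (c ⬝ᵥ v) ^ 2 / (ν * (c ⬝ᵥ u)) := by
  have hx : 0 < (c ⬝ᵥ v) ^ 2 / (ν * (c ⬝ᵥ u) * η) := by positivity
  have hres := hA.posSemidef.dotProduct_mulVec_nonneg (v - (c ⬝ᵥ v / c ⬝ᵥ u) • u)
  rw [star_trivial] at hres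
  rw [blockObjective_eq_add hν (by simpa using hA.isHermitian) hu hk hη hv] at h
  constructor
  · by_contra hne
    have hpos := hA.dotProduct_mulVec_pos (sub_ne_zero.2 hne)
    rw [star_trivial] at hpos
    linarith [Real.log_le_sub_one_of_pos hx, div_pos hpos (by positivity : 0 < ν * η)]
  · by_contra hne
    have hx1 : (c ⬝ᵥ v) ^ 2 / (ν * (c ⬝ᵥ u) * η) ≠ 1 := fun h1 => hne (by
      rw [div_eq_one_iff_eq (by positivity)] at h1
      rw [h1]
      field_simp)
    linarith [Real.log_lt_sub_one_of_pos hx hx1, div_nonneg hres (by positivity : 0 ≤ ν * η)]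

variable {o : κ}

theorem isBlockCoord_normalize (hν : 0 < ν) (hk : 0 < c ⬝ᵥ u) (ho : u o ≠ 0) :
    IsBlockCoord o c ((u o)⁻¹ • u) ((c ⬝ᵥ u) / (ν * u o ^ 2)) where
  apply_self := by simp [ho]
  pos := by positivity
  dotProduct_ne_zero := by
    rw [dotProduct_smul, smul_eq_mul]
    positivity

theorem blockObjective_normalize (hν : 0 < ν) (hu : A *ᵥ u = c) (hk : 0 < c ⬝ᵥ u) (ho : u o ≠ 0) :
    blockObjective ν A c ((u o)⁻¹ • u) ((c ⬝ᵥ u) / (ν * u o ^ 2)) =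
      Real.log (ν * (c ⬝ᵥ u)) - 1 := by
  rw [blockObjective, Matrix.mulVec_smul, hu, dotProduct_smul, dotProduct_smul, smul_dotProduct,
    dotProduct_comm u c]
  simp only [smul_eq_mul]
  congr 1
  · congr 1
    field_simp
  · field_simp

theorem IsBlockCoord.eq_normalize (h : IsBlockCoord o c v η) (hν : 0 < ν) (hA : A.PosDef)
    (hu : A *ᵥ u = c) (hk : 0 < c ⬝ᵥ u)
    (hle : Real.log (ν * (c ⬝ᵥ u)) - 1 ≤ blockObjective ν A c v η) :
    v = (u o)⁻¹ • u ∧ η = (c ⬝ᵥ u) / (ν * u o ^ 2) := by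
  obtain ⟨hv, hη⟩ := eq_smul_of_le_blockObjective hν hA hu hk h.pos h.dotProduct_ne_zero hle
  have hself := congrFun hv o
  rw [h.apply_self, Pi.smul_apply, smul_eq_mul] at hself
  have hvu : v = (u o)⁻¹ • u := by rw [hv, eq_inv_of_mul_eq_one_left hself.symm]
  refine ⟨hvu, ?_⟩
  have ho : u o ≠ 0 := right_ne_zero_of_mul (hself ▸ one_ne_zero)
  rw [hη, hvu, dotProduct_smul, smul_eq_mul]
  field_simp

end Maximum

section Degenerate

variable {ν η : ℝ} {A : Matrix κ κ ℝ} {a c v : κ → ℝ}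

theorem blockObjective_smul {m : ℝ} (hm : m ≠ 0) :
    blockObjective ν A c (m • v) (m ^ 2 * η) = blockObjective ν A c v η := by
  have hm2 : m ^ 2 ≠ 0 := pow_ne_zero 2 hm
  rw [blockObjective, blockObjective, Matrix.mulVec_smul, dotProduct_smul, dotProduct_smul,
    smul_dotProduct, smul_eq_mul, smul_eq_mul, smul_eq_mul, mul_pow, mul_div_mul_left _ _ hm2,
    ← mul_assoc, ← sq, mul_left_comm ν, mul_div_mul_left _ _ hm2]

theorem sq_dotProduct_le_sq_dotProduct_add_smul {t : ℝ} (ht : 0 ≤ t * (c ⬝ᵥ v * c ⬝ᵥ a)) :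
    (c ⬝ᵥ v) ^ 2 ≤ (c ⬝ᵥ (v + t • a)) ^ 2 := by
  rw [dotProduct_add, dotProduct_smul, smul_eq_mul]
  nlinarith [sq_nonneg (t * (c ⬝ᵥ a))]

theorem blockObjective_le_blockObjective_add_smul (hA : A.IsSymm) (ha : A *ᵥ a = 0) (hη : 0 < η)
    (hv : c ⬝ᵥ v ≠ 0) {t : ℝ} (ht : 0 ≤ t * (c ⬝ᵥ v * c ⬝ᵥ a)) :
    blockObjective ν A c v η ≤ blockObjective ν A c (v + t • a) η := by
  have hav : a ⬝ᵥ A *ᵥ v = 0 := by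
    rw [Matrix.dotProduct_mulVec, ← Matrix.mulVec_transpose, hA.eq, ha, zero_dotProduct]
  have hquad : (v + t • a) ⬝ᵥ A *ᵥ (v + t • a) = v ⬝ᵥ A *ᵥ v := by
    rw [Matrix.mulVec_add, Matrix.mulVec_smul, ha, smul_zero, add_zero, add_dotProduct,
      smul_dotProduct, hav, smul_zero, add_zero]
  have hlog := sq_dotProduct_le_sq_dotProduct_add_smul ht
  rw [blockObjective, blockObjective, hquad]
  gcongr

theorem exists_ne_zero_one_add_mul_pos (x y : ℝ) : ∃ t : ℝ, t ≠ 0 ∧ 0 < 1 + t * x ∧ 0 ≤ t * y := by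
  have hd : 0 < 1 + |x| := by positivity
  have hlt : |(1 + |x|)⁻¹ * x| < 1 := by
    rw [abs_mul, abs_of_pos (inv_pos.2 hd), inv_mul_lt_one₀ hd]
    linarith
  rw [abs_lt] at hlt
  rcases le_total 0 y with hy | hy
  · exact ⟨(1 + |x|)⁻¹, by positivity, by linarith, by positivity⟩
  · exact ⟨-(1 + |x|)⁻¹, by simpa using hd.ne', by linarith,
      mul_nonneg_of_nonpos_of_nonpos (by simpa using hd.le) hy⟩

theorem IsBlockCoord.exists_ne_blockObjective_le {o : κ} (h : IsBlockCoord o c v η)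
    (hA : A.IsSymm) (ha0 : a ≠ 0) (ha : A *ᵥ a = 0) :
    ∃ v' η', IsBlockCoord o c v' η' ∧ (v', η') ≠ (v, η) ∧
      blockObjective ν A c v η ≤ blockObjective ν A c v' η' := by
  obtain ⟨t, ht0, hm, ht⟩ := exists_ne_zero_one_add_mul_pos (a o) (c ⬝ᵥ v * c ⬝ᵥ a)
  have hcv : c ⬝ᵥ (v + t • a) ≠ 0 := fun h0 => h.dotProduct_ne_zero <| by
    simpa [h0, sq_nonpos_iff] using sq_dotProduct_le_sq_dotProduct_add_smul ht
  set m := 1 + t * a o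
  refine ⟨m⁻¹ • (v + t • a), m⁻¹ ^ 2 * η, ⟨?_, ?_, ?_⟩, fun heq => ?_, ?_⟩
  · simpa [h.apply_self] using inv_mul_cancel₀ hm.ne'
  · have := h.pos
    positivity
  · rw [dotProduct_smul, smul_eq_mul]
    exact mul_ne_zero (inv_ne_zero hm.ne') hcv
  · obtain ⟨hv, hη⟩ := Prod.ext_iff.1 heq
    have hm1 : m⁻¹ = 1 := by
      have := mul_right_cancel₀ h.pos.ne' (hη.trans (one_mul η).symm)
      exact (pow_eq_one_iff_of_nonneg (by positivity) two_ne_zero).1 this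
    rw [hm1, one_smul, add_eq_left, smul_eq_zero] at hv
    exact hv.elim ht0 ha0
  · rw [blockObjective_smul (inv_ne_zero hm.ne')]
    exact blockObjective_le_blockObjective_add_smul hA ha h.pos h.dotProduct_ne_zero ht

end Degenerate

end BlockObjective

/-! ### Coordinates for block updates -/

theorem one_sub_updateRow_single_sub {V R : Type*} [DecidableEq V] [Ring R] (B : Matrix V V R)
    (i : V) (r : V → R) : 1 - B.updateRow i (Pi.single i 1 - r) = (1 - B).updateRow i r := by
  ext a b
  by_cases ha : a = i
  · subst ha
    simp [Matrix.one_apply, Pi.single_apply, eq_comm]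
  · simp [ha]

theorem det_updateRow_eq_dotProduct_adjugate {V R : Type*} [Fintype V] [DecidableEq V] [CommRing R]
    (A : Matrix V V R) (i : V) (r : V → R) :
    (A.updateRow i r).det = r ⬝ᵥ fun j => A.adjugate j i := by
  rw [Matrix.det_eq_sum_mul_adjugate_row _ i]
  simp [dotProduct, Matrix.adjugate_apply]

theorem trace_vecMulVec_mul_mul_transpose {m n R : Type*} [Fintype m] [Fintype n] [CommSemiring R]
    (q : m → R) (Y : Matrix m n R) :
    (Matrix.vecMulVec q q * (Y * Yᵀ)).trace = (q ᵥ* Y) ⬝ᵥ (q ᵥ* Y) := by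
  rw [Matrix.vecMulVec_mul, Matrix.trace_vecMulVec, dotProduct_comm, ← Matrix.vecMul_vecMul,
    ← Matrix.dotProduct_mulVec, Matrix.mulVec_transpose]

theorem vecMul_updateRow_of_apply_eq_zero {m n R : Type*} [Fintype m] [DecidableEq m]
    [NonUnitalNonAssocSemiring R] {u : m → R} {i : m} (hu : u i = 0) (M : Matrix m n R)
    (r : n → R) : u ᵥ* M.updateRow i r = u ᵥ* M := by
  ext b
  refine Finset.sum_congr rfl fun a _ => ?_
  by_cases ha : a = i
  · rw [ha, hu, zero_mul, zero_mul]
  · simp only [Matrix.updateRow_ne ha]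

namespace MixedGraph

theorem isSymm_of_mem_OmegaSet {V : Type*} {G : MixedGraph V} {Om : Matrix V V ℝ}
    (h : Om ∈ G.OmegaSet) : Om.IsSymm := by
  simpa using h.1.isHermitian

/-- The index set of the regression problem for the block update at `i`: the node `i` and its
parents, and the siblings of `i`. -/
inductive BlockIndex {V : Type*} (G : MixedGraph V) (i : V) : Type _
  | pa (j : V) (h : j = i ∨ G.dir j i)
  | sib (j : V) (h : G.bi.Adj j i)

section Incidence

variable {V : Type*} (G : MixedGraph V) (i : V)

instance [Finite V] : Finite (G.BlockIndex i) :=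
  Finite.of_injective (β := V ⊕ V) (fun k => match k with | .pa j _ => .inl j | .sib j _ => .inr j)
    (by rintro (_ | _) (_ | _) h <;> simp_all)

noncomputable instance [Finite V] : Fintype (G.BlockIndex i) := Fintype.ofFinite _

noncomputable instance : DecidableEq (G.BlockIndex i) := Classical.decEq _

/-- The index of the node `i` itself, whose coefficient is normalized to one. -/
def blockSelf : G.BlockIndex i := .pa i (Or.inl rfl)

variable [DecidableEq V]

/-- The incidence matrix of the indices that stand for `i` and its parents: `v ᵥ* paIncidence` is
the `i`-th row of `1 - B` with coefficients `v`. -/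
def paIncidence : Matrix (G.BlockIndex i) V ℝ :=
  Matrix.of fun k => match k with
    | .pa j _ => Pi.single j 1
    | .sib _ _ => 0

/-- The incidence matrix of the indices that stand for the siblings of `i`: up to sign,
`v ᵥ* sibIncidence` is the off-diagonal `i`-th row of `Ω` with coefficients `v`. -/
def sibIncidence : Matrix (G.BlockIndex i) V ℝ :=
  Matrix.of fun k => match k with
    | .pa _ _ => 0
    | .sib j _ => Pi.single j 1

variable [Finite V] {G i} (v : G.BlockIndex i → ℝ) {j : V}

theorem vecMul_paIncidence_apply (h : j = i ∨ G.dir j i) :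
    (v ᵥ* G.paIncidence i) j = v (.pa j h) := by
  rw [Matrix.vecMul, dotProduct, Finset.sum_eq_single (.pa j h)]
  · simp [paIncidence]
  · rintro (⟨a, ha⟩ | ⟨a, ha⟩) - hne
    · have : j ≠ a := by rintro rfl; exact hne rfl
      simp [paIncidence, this]
    · simp [paIncidence]
  · simp

theorem vecMul_paIncidence_apply_eq_zero (h : ¬ (j = i ∨ G.dir j i)) :
    (v ᵥ* G.paIncidence i) j = 0 := by
  rw [Matrix.vecMul, dotProduct]
  refine Finset.sum_eq_zero ?_
  rintro (⟨a, ha⟩ | ⟨a, ha⟩) -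
  · have : j ≠ a := by rintro rfl; exact h ha
    simp [paIncidence, this]
  · simp [paIncidence]

theorem vecMul_sibIncidence_apply (h : G.bi.Adj j i) :
    (v ᵥ* G.sibIncidence i) j = v (.sib j h) := by
  rw [Matrix.vecMul, dotProduct, Finset.sum_eq_single (.sib j h)]
  · simp [sibIncidence]
  · rintro (⟨a, ha⟩ | ⟨a, ha⟩) - hne
    · simp [sibIncidence]
    · have : j ≠ a := by rintro rfl; exact hne rfl
      simp [sibIncidence, this]
  · simp

theorem vecMul_sibIncidence_apply_eq_zero (h : ¬ G.bi.Adj j i) :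
    (v ᵥ* G.sibIncidence i) j = 0 := by
  rw [Matrix.vecMul, dotProduct]
  refine Finset.sum_eq_zero ?_
  rintro (⟨a, ha⟩ | ⟨a, ha⟩) -
  · simp [sibIncidence]
  · have : j ≠ a := by rintro rfl; exact h ha
    simp [sibIncidence, this]

theorem vecMul_sibIncidence_self : (v ᵥ* G.sibIncidence i) i = 0 :=
  vecMul_sibIncidence_apply_eq_zero v (G.bi.loopless.irrefl i)

theorem eq_of_vecMul_incidence_eq {v v' : G.BlockIndex i → ℝ}
    (hpa : v ᵥ* G.paIncidence i = v' ᵥ* G.paIncidence i)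
    (hsib : v ᵥ* G.sibIncidence i = v' ᵥ* G.sibIncidence i) : v = v' := by
  ext k
  rcases k with ⟨j, hj⟩ | ⟨j, hj⟩
  · simpa only [vecMul_paIncidence_apply _ hj] using congrFun hpa j
  · simpa only [vecMul_sibIncidence_apply _ hj] using congrFun hsib j

theorem exists_vecMul_incidence_eq {r w : V → ℝ} (hr : ∀ j, j ≠ i → ¬ G.dir j i → r j = 0)
    (hw : ∀ j, ¬ G.bi.Adj j i → w j = 0) :
    ∃ v : G.BlockIndex i → ℝ, v ᵥ* G.paIncidence i = r ∧ v ᵥ* G.sibIncidence i = w := by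
  refine ⟨fun k => match k with | .pa j _ => r j | .sib j _ => w j, ?_, ?_⟩
  · ext j
    by_cases hj : j = i ∨ G.dir j i
    · rw [vecMul_paIncidence_apply _ hj]
    · rw [vecMul_paIncidence_apply_eq_zero _ hj]
      rw [not_or] at hj
      rw [hr j hj.1 hj.2]
  · ext j
    by_cases hj : G.bi.Adj j i
    · rw [vecMul_sibIncidence_apply _ hj]
    · rw [vecMul_sibIncidence_apply_eq_zero _ hj, hw j hj]

end Incidence

section BlockPoint

variable {V : Type*} [Fintype V] [DecidableEq V] (G : MixedGraph V) (i : V)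
  (θ : Matrix V V ℝ × Matrix V V ℝ)

/-- The regressors of the block update at `i`, as linear combinations of the rows of the data
matrix: the data at `i` and its parents, and, for each sibling, the pseudo-variable given by the
row of `Ω₋ᵢ⁻¹ (1 - B)`, where `Ω₋ᵢ` is `Ω` without the `i`-th row and column. -/
noncomputable def blockRows : Matrix (G.BlockIndex i) V ℝ :=
  G.paIncidence i + G.sibIncidence i * ((bordered θ.2 i 0 1)⁻¹ * (1 - θ.1))

/-- The Gram matrix of the regressors of the block update at `i`. -/
noncomputable def blockGram {N : ℕ} (Y : Matrix V (Fin N) ℝ) :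
    Matrix (G.BlockIndex i) (G.BlockIndex i) ℝ :=
  (G.blockRows i θ * Y) * (G.blockRows i θ * Y)ᵀ

/-- The coefficients of `det (1 - B)` as a linear function of the `i`-th row of `1 - B`. -/
noncomputable def blockCofactor : G.BlockIndex i → ℝ :=
  G.paIncidence i *ᵥ fun j => (1 - θ.1).adjugate j i

/-- The coefficients of the regression of the error at `i` on the other errors. -/
noncomputable def sibCoeff (v : G.BlockIndex i → ℝ) : V → ℝ :=
  -(v ᵥ* G.sibIncidence i) ᵥ* (bordered θ.2 i 0 1)⁻¹

/-- The pair of matrices with coordinates `v` and `η` in the block update problem at `i`: the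
`i`-th row of `1 - B` and the off-diagonal entries of the `i`-th row of `Ω` have the coefficients
`v`, and `η` is the conditional variance of the error at `i` given the other errors. -/
noncomputable def blockPoint (v : G.BlockIndex i → ℝ) (η : ℝ) : Matrix V V ℝ × Matrix V V ℝ :=
  (θ.1.updateRow i (Pi.single i 1 - v ᵥ* G.paIncidence i),
    bordered θ.2 i (-(v ᵥ* G.sibIncidence i)) (η + G.sibCoeff i θ v ⬝ᵥ -(v ᵥ* G.sibIncidence i)))

variable {G i θ} (v : G.BlockIndex i → ℝ) (η : ℝ)

theorem one_sub_blockPoint_fst :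
    1 - (G.blockPoint i θ v η).1 = (1 - θ.1).updateRow i (v ᵥ* G.paIncidence i) :=
  one_sub_updateRow_single_sub _ _ _

theorem det_one_sub_blockPoint_fst :
    (1 - (G.blockPoint i θ v η).1).det = G.blockCofactor i θ ⬝ᵥ v := by
  rw [one_sub_blockPoint_fst, det_updateRow_eq_dotProduct_adjugate, blockCofactor,
    dotProduct_comm _ v, Matrix.dotProduct_mulVec]

theorem blockPoint_snd_apply_self : (G.blockPoint i θ v η).2 i i =
    η + G.sibCoeff i θ v ⬝ᵥ -(v ᵥ* G.sibIncidence i) :=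
  bordered_apply_self ..

theorem sibCoeff_vecMul_bordered (hdet : (bordered θ.2 i 0 1).det ≠ 0) :
    G.sibCoeff i θ v ᵥ* bordered θ.2 i 0 1 = -(v ᵥ* G.sibIncidence i) := by
  rw [sibCoeff, Matrix.vecMul_vecMul, Matrix.nonsing_inv_mul _ hdet.isUnit, Matrix.vecMul_one]

theorem sibCoeff_self (hdet : (bordered θ.2 i 0 1).det ≠ 0) : G.sibCoeff i θ v i = 0 := by
  rw [← mul_one (G.sibCoeff i θ v i), ← vecMul_bordered_zero_apply_self θ.2,
    sibCoeff_vecMul_bordered v hdet, Pi.neg_apply, vecMul_sibIncidence_self, neg_zero]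

theorem vecMul_blockRows :
    v ᵥ* G.blockRows i θ = v ᵥ* G.paIncidence i - G.sibCoeff i θ v ᵥ* (1 - θ.1) := by
  rw [blockRows, sibCoeff, Matrix.vecMul_add, Matrix.neg_vecMul, Matrix.neg_vecMul, sub_neg_eq_add,
    ← Matrix.vecMul_vecMul, ← Matrix.vecMul_vecMul]

theorem blockPoint_snd_eq_rowShear_mul (hsymm : θ.2.IsSymm)
    (hdet : (bordered θ.2 i 0 1).det ≠ 0) : (G.blockPoint i θ v η).2 =
      rowShear i (G.sibCoeff i θ v) * bordered θ.2 i 0 η * (rowShear i (G.sibCoeff i θ v))ᵀ := by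
  rw [rowShear_mul_bordered_mul_transpose hsymm (sibCoeff_self v hdet),
    sibCoeff_vecMul_bordered v hdet, blockPoint]

theorem rowShear_neg_mul_one_sub_blockPoint (hdet : (bordered θ.2 i 0 1).det ≠ 0) :
    rowShear i (-G.sibCoeff i θ v) * (1 - (G.blockPoint i θ v η).1) =
      (1 - θ.1).updateRow i (v ᵥ* G.blockRows i θ) := by
  rw [rowShear_mul, one_sub_blockPoint_fst, Matrix.neg_vecMul,
    vecMul_updateRow_of_apply_eq_zero (sibCoeff_self v hdet), Matrix.updateRow_self,
    Matrix.updateRow_idem, ← sub_eq_add_neg, ← vecMul_blockRows]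

theorem posDef_blockPoint_snd_iff (hO : θ.2.PosDef) :
    (G.blockPoint i θ v η).2.PosDef ↔ 0 < η := by
  have hdet := (posDef_bordered_zero hO i one_pos).det_pos.ne'
  have hunit : IsUnit (rowShear i (G.sibCoeff i θ v)) := by
    rw [Matrix.isUnit_iff_isUnit_det, det_rowShear (sibCoeff_self v hdet)]
    exact isUnit_one
  rw [blockPoint_snd_eq_rowShear_mul v η (by simpa using hO.isHermitian) hdet]
  refine (Matrix.IsUnit.posDef_star_right_conjugate_iff hunit).trans ⟨fun h => ?_,
    posDef_bordered_zero hO i⟩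
  simpa [bordered_apply_self] using h.diag_pos (i := i)

theorem blockPoint_mem_blockFeasible (hB : θ.1 ∈ G.BSet) (hO : θ.2 ∈ G.OmegaSet) {v} {η}
    (h : IsBlockCoord (G.blockSelf i) (G.blockCofactor i θ) v η) :
    G.blockPoint i θ v η ∈ G.blockFeasible i θ := by
  refine ⟨⟨?_, fun a b hab => ?_⟩, ⟨(posDef_blockPoint_snd_iff v η hO.1).2 h.pos,
    fun a b hne hab => ?_⟩, fun a b ha => ?_, fun a b ha hb => ?_⟩
  · rw [Matrix.isUnit_iff_isUnit_det, det_one_sub_blockPoint_fst]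
    exact h.dotProduct_ne_zero.isUnit
  · by_cases ha : a = i
    · subst ha
      simp only [blockPoint, Matrix.updateRow_self, Pi.sub_apply]
      by_cases hb : b = a
      · subst hb
        rw [vecMul_paIncidence_apply v (Or.inl rfl), Pi.single_eq_same]
        exact sub_eq_zero.2 h.apply_self.symm
      · rw [vecMul_paIncidence_apply_eq_zero v (by tauto), Pi.single_eq_of_ne hb, sub_zero]
    · simp only [blockPoint, Matrix.updateRow_ne ha]
      exact hB.2 a b hab
  · simp only [blockPoint, bordered_apply]
    split_ifs with ha hb hb
    · exact absurd (ha.trans hb.symm) hne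
    · subst ha
      rw [Pi.neg_apply, vecMul_sibIncidence_apply_eq_zero v hab, neg_zero]
    · subst hb
      rw [Pi.neg_apply, vecMul_sibIncidence_apply_eq_zero v fun h => hab h.symm, neg_zero]
    · exact hO.2 a b hne hab
  · simp [blockPoint, Matrix.updateRow_ne ha]
  · simp [blockPoint, bordered, ha, hb]

theorem exists_eq_blockPoint {θ' : Matrix V V ℝ × Matrix V V ℝ}
    (h : θ' ∈ G.blockFeasible i θ) :
    ∃ v η, v (G.blockSelf i) = 1 ∧ G.blockPoint i θ v η = θ' := by
  obtain ⟨hB', hO', hrow, hblk⟩ := h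
  obtain ⟨v, hpa, hsib⟩ : ∃ v : G.BlockIndex i → ℝ, v ᵥ* G.paIncidence i = (1 - θ'.1) i ∧
      v ᵥ* G.sibIncidence i = -Function.update (θ'.2 i) i 0 := by
    refine exists_vecMul_incidence_eq (fun j hj hdir => ?_) fun j hadj => ?_
    · simp [hj.symm, hB'.2 i j hdir]
    · by_cases hj : j = i
      · simp [hj]
      · simp [hj, hO'.2 i j (Ne.symm hj) hadj]
  refine ⟨v, θ'.2 i i - G.sibCoeff i θ v ⬝ᵥ -(v ᵥ* G.sibIncidence i), ?_,
    Prod.ext (Matrix.ext fun a b => ?_) (Matrix.ext fun a b => ?_)⟩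
  · rw [blockSelf, ← vecMul_paIncidence_apply v (Or.inl rfl), hpa]
    simp [hB'.2 i i (G.dir_irrefl i)]
  · by_cases ha : a = i
    · subst ha
      simp [blockPoint, hpa, Pi.single_apply, Matrix.one_apply, eq_comm]
    · simp [blockPoint, Matrix.updateRow_ne ha, hrow a b ha]
  · simp only [blockPoint, hsib, neg_neg, sub_add_cancel, bordered_apply]
    split_ifs with ha hb hb
    · rw [ha, hb]
    · rw [ha, Function.update_of_ne hb]
    · rw [hb, Function.update_of_ne ha, (isSymm_of_mem_OmegaSet hO').apply]
    · exact (hblk a b ha hb).symm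

theorem mem_blockFeasible_iff (hB : θ.1 ∈ G.BSet) (hO : θ.2 ∈ G.OmegaSet)
    {θ' : Matrix V V ℝ × Matrix V V ℝ} : θ' ∈ G.blockFeasible i θ ↔
      ∃ v η, IsBlockCoord (G.blockSelf i) (G.blockCofactor i θ) v η ∧
        G.blockPoint i θ v η = θ' := by
  constructor
  · intro h
    obtain ⟨v, η, hself, rfl⟩ := exists_eq_blockPoint h
    refine ⟨v, η, ⟨hself, (posDef_blockPoint_snd_iff v η hO.1).1 h.2.1.1, ?_⟩, rfl⟩
    rw [← det_one_sub_blockPoint_fst v η]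
    exact ((Matrix.isUnit_iff_isUnit_det _).1 h.1.1).ne_zero
  · rintro ⟨v, η, h, rfl⟩
    exact blockPoint_mem_blockFeasible hB hO h

theorem blockPoint_injective {v v' : G.BlockIndex i → ℝ} {η η' : ℝ}
    (h : G.blockPoint i θ v η = G.blockPoint i θ v' η') : v = v' ∧ η = η' := by
  obtain ⟨hfst, hsnd⟩ := Prod.ext_iff.1 h
  have hpa : v ᵥ* G.paIncidence i = v' ᵥ* G.paIncidence i := by
    simpa [blockPoint] using congrFun hfst i
  have hsib : v ᵥ* G.sibIncidence i = v' ᵥ* G.sibIncidence i := by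
    ext j
    by_cases hj : j = i
    · subst hj; rw [vecMul_sibIncidence_self, vecMul_sibIncidence_self]
    · simpa [blockPoint, bordered, hj] using congrFun (congrFun hsnd i) j
  obtain rfl := eq_of_vecMul_incidence_eq hpa hsib
  have hdiag := congrFun (congrFun hsnd i) i
  rw [blockPoint_snd_apply_self, blockPoint_snd_apply_self, add_left_inj] at hdiag
  exact ⟨rfl, hdiag⟩

end BlockPoint
end MixedGraph

/-! ### Solutions of block updates -/

namespace MixedGraph

variable {V : Type*} [Fintype V] [DecidableEq V] {G : MixedGraph V} {i : V}
  {θ : Matrix V V ℝ × Matrix V V ℝ}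

section LogLik

theorem det_covariance_blockPoint (hsymm : θ.2.IsSymm) (hdet : (bordered θ.2 i 0 1).det ≠ 0)
    (v : G.BlockIndex i → ℝ) (η : ℝ) :
    ((1 - (G.blockPoint i θ v η).1)⁻¹ * (G.blockPoint i θ v η).2 *
      (1 - (G.blockPoint i θ v η).1)⁻¹ᵀ).det =
        η * (bordered θ.2 i 0 1).det / (G.blockCofactor i θ ⬝ᵥ v) ^ 2 := by
  rw [Matrix.det_mul, Matrix.det_mul, Matrix.det_transpose, Matrix.det_nonsing_inv,
    Ring.inverse_eq_inv', det_one_sub_blockPoint_fst, blockPoint_snd_eq_rowShear_mul v η hsymm hdet,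
    Matrix.det_mul, Matrix.det_mul, Matrix.det_transpose, det_rowShear (sibCoeff_self v hdet),
    det_bordered_zero]
  ring

theorem precision_blockPoint (hsymm : θ.2.IsSymm) (hdet : (bordered θ.2 i 0 1).det ≠ 0)
    (v : G.BlockIndex i → ℝ) {η : ℝ} (hη : η ≠ 0) :
    (1 - (G.blockPoint i θ v η).1)ᵀ * (G.blockPoint i θ v η).2⁻¹ *
      (1 - (G.blockPoint i θ v η).1) =
        ((1 - θ.1).updateRow i 0)ᵀ * (bordered θ.2 i 0 1)⁻¹ * (1 - θ.1).updateRow i 0 +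
          η⁻¹ • Matrix.vecMulVec (v ᵥ* G.blockRows i θ) (v ᵥ* G.blockRows i θ) := by
  rw [blockPoint_snd_eq_rowShear_mul v η hsymm hdet, Matrix.mul_inv_rev, Matrix.mul_inv_rev,
    ← Matrix.transpose_nonsing_inv, inv_rowShear (sibCoeff_self v hdet)]
  calc
    _ = (rowShear i (-G.sibCoeff i θ v) * (1 - (G.blockPoint i θ v η).1))ᵀ *
          (bordered θ.2 i 0 η)⁻¹ *
            (rowShear i (-G.sibCoeff i θ v) * (1 - (G.blockPoint i θ v η).1)) := by
      simp only [Matrix.transpose_mul, Matrix.mul_assoc]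
    _ = _ := by
      rw [rowShear_neg_mul_one_sub_blockPoint v η hdet, inv_bordered_zero hdet hη,
        transpose_mul_bordered_zero_mul, Matrix.updateRow_idem, Matrix.updateRow_self]

variable {N : ℕ} (Y : Matrix V (Fin N) ℝ)

theorem dotProduct_blockGram_mulVec (v v' : G.BlockIndex i → ℝ) :
    v ⬝ᵥ G.blockGram i θ Y *ᵥ v' =
      (v ᵥ* G.blockRows i θ ᵥ* Y) ⬝ᵥ (v' ᵥ* G.blockRows i θ ᵥ* Y) := by
  rw [blockGram, ← Matrix.mulVec_mulVec, Matrix.dotProduct_mulVec, Matrix.mulVec_transpose,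
    Matrix.vecMul_vecMul, Matrix.vecMul_vecMul]

theorem exists_logLik_blockPoint_eq_add (hO : θ.2.PosDef) :
    ∃ K : ℝ, ∀ (v : G.BlockIndex i → ℝ) (η : ℝ),
      IsBlockCoord (G.blockSelf i) (G.blockCofactor i θ) v η →
        logLik Y (G.blockPoint i θ v η) =
          K + blockObjective N (G.blockGram i θ Y) (G.blockCofactor i θ) v η := by
  have hsymm : θ.2.IsSymm := by simpa using hO.isHermitian
  have hdet := (posDef_bordered_zero hO i one_pos).det_pos.ne'
  refine ⟨-Real.log (bordered θ.2 i 0 1).det - (((1 - θ.1).updateRow i 0)ᵀ *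
    (bordered θ.2 i 0 1)⁻¹ * (1 - θ.1).updateRow i 0 * ((1 / (N : ℝ)) • (Y * Yᵀ))).trace,
    fun v η h => ?_⟩
  have hc : (G.blockCofactor i θ ⬝ᵥ v) ^ 2 ≠ 0 := pow_ne_zero 2 h.dotProduct_ne_zero
  rw [logLik, det_covariance_blockPoint hsymm hdet, precision_blockPoint hsymm hdet v h.pos.ne',
    Matrix.add_mul, Matrix.trace_add, Matrix.smul_mul, Matrix.mul_smul (Matrix.vecMulVec _ _),
    Matrix.trace_smul, Matrix.trace_smul, trace_vecMulVec_mul_mul_transpose,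
    ← dotProduct_blockGram_mulVec, blockObjective, Real.log_div (mul_ne_zero h.pos.ne' hdet) hc,
    Real.log_mul h.pos.ne' hdet, Real.log_div hc h.pos.ne']
  simp only [smul_eq_mul, mul_inv_rev, div_eq_mul_inv, one_mul]
  ring

end LogLik

section Solution

variable {N : ℕ} {Y : Matrix V (Fin N) ℝ}

theorem isBlockSolution_blockPoint_iff (hB : θ.1 ∈ G.BSet) (hO : θ.2 ∈ G.OmegaSet)
    {v : G.BlockIndex i → ℝ} {η : ℝ}
    (h : IsBlockCoord (G.blockSelf i) (G.blockCofactor i θ) v η) :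
    G.IsBlockSolution Y i θ (G.blockPoint i θ v η) ↔
      ∀ v' η', IsBlockCoord (G.blockSelf i) (G.blockCofactor i θ) v' η' →
        blockObjective N (G.blockGram i θ Y) (G.blockCofactor i θ) v' η' ≤
          blockObjective N (G.blockGram i θ Y) (G.blockCofactor i θ) v η := by
  obtain ⟨K, hK⟩ := exists_logLik_blockPoint_eq_add (G := G) (i := i) Y hO.1
  have hle : ∀ v' η', IsBlockCoord (G.blockSelf i) (G.blockCofactor i θ) v' η' →
      (logLik Y (G.blockPoint i θ v' η') ≤ logLik Y (G.blockPoint i θ v η) ↔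
        blockObjective N (G.blockGram i θ Y) (G.blockCofactor i θ) v' η' ≤
          blockObjective N (G.blockGram i θ Y) (G.blockCofactor i θ) v η) := fun v' η' h' => by
    rw [hK v' η' h', hK v η h, add_le_add_iff_left]
  constructor
  · exact fun hsol v' η' h' =>
      (hle v' η' h').1 (isMaxOn_iff.1 hsol.2 _ (blockPoint_mem_blockFeasible hB hO h'))
  · intro hmax
    refine ⟨blockPoint_mem_blockFeasible hB hO h, isMaxOn_iff.2 fun θ' hθ' => ?_⟩
    obtain ⟨v', η', h', rfl⟩ := (mem_blockFeasible_iff hB hO).1 hθ'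
    exact (hle v' η' h').2 (hmax v' η' h')

theorem isSymm_blockGram : (G.blockGram i θ Y).IsSymm := by
  rw [Matrix.IsSymm, blockGram, Matrix.transpose_mul, Matrix.transpose_transpose]

theorem posDef_blockGram (h : (G.blockGram i θ Y).det ≠ 0) : (G.blockGram i θ Y).PosDef := by
  have hpsd : (G.blockGram i θ Y).PosSemidef := by
    simpa [blockGram] using Matrix.posSemidef_self_mul_conjTranspose (G.blockRows i θ * Y)
  exact hpsd.posDef_iff_isUnit.2 ((Matrix.isUnit_iff_isUnit_det _).2 h.isUnit)

variable (G i θ Y)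

/-- The solution of the normal equations of the block update at `i`. -/
noncomputable def blockNormal : G.BlockIndex i → ℝ :=
  (G.blockGram i θ Y)⁻¹ *ᵥ G.blockCofactor i θ

/-- The block update at `i` in closed form: the coefficients are the solution of the normal
equations, rescaled so that the coefficient of `i` is one. It is the unique solution of the block
update problem if the Gram matrix is invertible and the rescaling is possible. -/
noncomputable def blockUpdate : Matrix V V ℝ × Matrix V V ℝ :=
  G.blockPoint i θ ((G.blockNormal i θ Y (G.blockSelf i))⁻¹ • G.blockNormal i θ Y)
    ((G.blockCofactor i θ ⬝ᵥ G.blockNormal i θ Y) / (N * G.blockNormal i θ Y (G.blockSelf i) ^ 2))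

variable {G i θ Y}

theorem blockGram_mulVec_blockNormal (hdet : (G.blockGram i θ Y).det ≠ 0) :
    G.blockGram i θ Y *ᵥ G.blockNormal i θ Y = G.blockCofactor i θ := by
  rw [blockNormal, Matrix.mulVec_mulVec, Matrix.mul_nonsing_inv _ hdet.isUnit, Matrix.one_mulVec]

theorem blockCofactor_dotProduct_blockNormal_pos (hdet : (G.blockGram i θ Y).det ≠ 0)
    (hself : G.blockNormal i θ Y (G.blockSelf i) ≠ 0) :
    0 < G.blockCofactor i θ ⬝ᵥ G.blockNormal i θ Y := by
  have hne : G.blockNormal i θ Y ≠ 0 := fun h => hself (congrFun h _)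
  rw [← blockGram_mulVec_blockNormal hdet, dotProduct_comm]
  simpa using (posDef_blockGram hdet).dotProduct_mulVec_pos hne

theorem isBlockSolution_iff_eq_blockUpdate (hN : 0 < N) (hB : θ.1 ∈ G.BSet) (hO : θ.2 ∈ G.OmegaSet)
    (hdet : (G.blockGram i θ Y).det ≠ 0) (hself : G.blockNormal i θ Y (G.blockSelf i) ≠ 0)
    {θ' : Matrix V V ℝ × Matrix V V ℝ} :
    G.IsBlockSolution Y i θ θ' ↔ θ' = G.blockUpdate i θ Y := by
  have hν : (0 : ℝ) < N := Nat.cast_pos.2 hN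
  have hA := posDef_blockGram hdet
  have hu := blockGram_mulVec_blockNormal hdet
  have hk := blockCofactor_dotProduct_blockNormal_pos hdet hself
  have hcoord := isBlockCoord_normalize hν hk hself
  constructor
  · intro h
    obtain ⟨v, η, hv, rfl⟩ := (mem_blockFeasible_iff hB hO).1 h.1
    have hle := (isBlockSolution_blockPoint_iff hB hO hv).1 h _ _ hcoord
    rw [blockObjective_normalize hν hu hk hself] at hle
    obtain ⟨rfl, rfl⟩ := hv.eq_normalize hν hA hu hk hle
    rfl
  · rintro rfl
    refine (isBlockSolution_blockPoint_iff hB hO hcoord).2 fun v η hv => ?_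
    rw [blockObjective_normalize hν hu hk hself]
    exact blockObjective_le hν hA hu hk hv.pos hv.dotProduct_ne_zero

theorem linearIndependent_blockRows_of_unique (hB : θ.1 ∈ G.BSet) (hO : θ.2 ∈ G.OmegaSet)
    {θ' : Matrix V V ℝ × Matrix V V ℝ} (hθ' : G.IsBlockSolution Y i θ θ')
    (huniq : ∀ θ'', G.IsBlockSolution Y i θ θ'' → θ'' = θ') :
    LinearIndependent ℝ (G.blockRows i θ).row := by
  refine linearIndependent_row_iff.2 fun a ha => by_contra fun ha0 => ?_
  have hAa : G.blockGram i θ Y *ᵥ a = 0 := by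
    rw [blockGram, ← Matrix.mulVec_mulVec, Matrix.mulVec_transpose, ← Matrix.vecMul_vecMul, ha,
      Matrix.zero_vecMul, Matrix.mulVec_zero]
  obtain ⟨v, η, hv, rfl⟩ := (mem_blockFeasible_iff hB hO).1 hθ'.1
  obtain ⟨v', η', hv', hne, hle⟩ :=
    hv.exists_ne_blockObjective_le (ν := N) isSymm_blockGram ha0 hAa
  obtain ⟨rfl, rfl⟩ := blockPoint_injective <| huniq _ <|
    (isBlockSolution_blockPoint_iff hB hO hv').2 fun v'' η'' hv'' =>
      ((isBlockSolution_blockPoint_iff hB hO hv).1 hθ' v'' η'' hv'').trans hle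
  exact hne rfl

end Solution
end MixedGraph

/-! ### The half-collider condition and linear independence of the regressors -/

namespace MixedGraph

variable {V : Type*} [Fintype V] [DecidableEq V] {G : MixedGraph V} {i : V}

section Rows

theorem vecMul_sibIncidence_vecMul_apply [Fintype {v : ({i}ᶜ : Set V) | (v : V) ∈ G.sib i}]
    (v : G.BlockIndex i → ℝ) (M : Matrix V V ℝ) (j : V) : (v ᵥ* G.sibIncidence i ᵥ* M) j =
      ∑ s : {v : ({i}ᶜ : Set V) | (v : V) ∈ G.sib i}, v (.sib s s.2) * M s j := by
  refine (Fintype.sum_of_injective (fun s : {v : ({i}ᶜ : Set V) | (v : V) ∈ G.sib i} => (s : V))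
    (fun s t h => Subtype.ext (Subtype.ext h)) _ _ (fun a ha => ?_) fun s => ?_).symm
  · have hadj : ¬ G.bi.Adj a i := fun h => ha ⟨⟨⟨a, h.ne⟩, h⟩, rfl⟩
    rw [vecMul_sibIncidence_apply_eq_zero v hadj, zero_mul]
  · rw [vecMul_sibIncidence_apply v s.2]

theorem linearIndependent_row_paIncidence_add_iff (M : Matrix V V ℝ) :
    LinearIndependent ℝ (G.paIncidence i + G.sibIncidence i * M).row ↔
      LinearIndependent ℝ (M.submatrix
        (fun s : {v : ({i}ᶜ : Set V) | (v : V) ∈ G.sib i} => (s : V))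
        (fun c : {v : ({i}ᶜ : Set V) | (v : V) ∉ G.pa i} => (c : V))).row := by
  classical
  have happly : ∀ v j, (v ᵥ* (G.paIncidence i + G.sibIncidence i * M)) j =
      (v ᵥ* G.paIncidence i) j +
        ∑ s : {v : ({i}ᶜ : Set V) | (v : V) ∈ G.sib i}, v (.sib s s.2) * M s j := fun v j => by
    rw [Matrix.vecMul_add, ← Matrix.vecMul_vecMul, Pi.add_apply, vecMul_sibIncidence_vecMul_apply]
  rw [linearIndependent_row_iff, linearIndependent_row_iff]
  constructor
  · intro h y hy
    let v : G.BlockIndex i → ℝ := fun k => match k with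
      | .pa j _ => -∑ s, y s * M s j
      | .sib j hj => y ⟨⟨j, hj.ne⟩, hj⟩
    have hv : v = 0 := h v <| funext fun j => by
      rw [happly, Pi.zero_apply]
      by_cases hj : j = i ∨ G.dir j i
      · rw [vecMul_paIncidence_apply v hj]
        exact neg_add_cancel _
      · rw [vecMul_paIncidence_apply_eq_zero v hj, zero_add]
        rw [not_or] at hj
        exact congrFun hy ⟨⟨j, hj.1⟩, hj.2⟩
    exact funext fun s => congrFun hv (.sib s s.2)
  · intro h v hv
    have hy : (fun s : {v : ({i}ᶜ : Set V) | (v : V) ∈ G.sib i} => v (.sib s s.2)) = 0 :=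
      h _ <| funext fun c => by
        have hc : ¬ ((c : V) = i ∨ G.dir c i) := not_or.2 ⟨c.1.2, c.2⟩
        have hvc := (happly v c).symm.trans (congrFun hv c)
        rwa [vecMul_paIncidence_apply_eq_zero v hc, zero_add] at hvc
    refine eq_of_vecMul_incidence_eq (funext fun j => ?_) (funext fun j => ?_)
    · have hj := (happly v j).symm.trans (congrFun hv j)
      simpa [fun s => congrFun hy s] using hj
    · by_cases hj : G.bi.Adj j i
      · rw [vecMul_sibIncidence_apply v hj, Matrix.zero_vecMul]
        exact congrFun hy ⟨⟨j, hj.ne⟩, hj⟩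
      · rw [vecMul_sibIncidence_apply_eq_zero v hj, Matrix.zero_vecMul, Pi.zero_apply]

theorem linearIndependent_blockRows_iff {θ : Matrix V V ℝ × Matrix V V ℝ}
    (hdet : (bordered θ.2 i 0 1).det ≠ 0) : LinearIndependent ℝ (G.blockRows i θ).row ↔
      LinearIndependent ℝ ((((θ.2.submatrix (↑) (↑))⁻¹ *
        (1 - θ.1.submatrix (↑) (↑)) : Matrix ({i}ᶜ : Set V) ({i}ᶜ : Set V) ℝ)).submatrix
          ((↑) : {v : ({i}ᶜ : Set V) | (v : V) ∈ G.sib i} → ({i}ᶜ : Set V))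
          ((↑) : {v : ({i}ᶜ : Set V) | (v : V) ∉ G.pa i} → ({i}ᶜ : Set V))).row := by
  have hsub : 1 - θ.1.submatrix ((↑) : ({i}ᶜ : Set V) → V) ((↑) : ({i}ᶜ : Set V) → V) =
      (1 - θ.1).submatrix (↑) (↑) := by
    rw [← Matrix.submatrix_one _ Subtype.val_injective]
    rfl
  rw [blockRows, linearIndependent_row_paIncidence_add_iff, hsub,
    ← submatrix_inv_bordered_mul hdet.isUnit, Matrix.submatrix_submatrix]
  rfl

end Rows

theorem halfColliderCondition_of_linearIndependent {θ : Matrix V V ℝ × Matrix V V ℝ}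
    (hB : G.DirSupported θ.1) (hO : θ.2 ∈ G.OmegaSet)
    (h : LinearIndependent ℝ (G.blockRows i θ).row) : G.HalfColliderCondition i := by
  have hdet := (posDef_bordered_zero hO.1 i one_pos).det_pos.ne'
  rw [linearIndependent_blockRows_iff hdet] at h
  obtain ⟨Sb, hSb, P, hP⟩ := exists_hasDisjointSystem_of_linearIndependent
    (H := G.induce {i}ᶜ) (fun a b hab => hB a b hab)
    (fun a b hne hab => hO.2 a b (Subtype.coe_injective.ne hne) hab)
    (hO.1.submatrix Subtype.val_injective).det_pos.ne' h
  exact ⟨Sb, fun v hv => not_or.2 ⟨hSb hv, v.2⟩, P, hP⟩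

theorem HalfColliderCondition.exists_linearIndependent (h : G.HalfColliderCondition i) :
    ∃ B Om : Matrix V V ℝ, G.DirSupported B ∧ Om.IsSymm ∧ G.BiSupported Om ∧
      (bordered Om i 0 1).det ≠ 0 ∧ LinearIndependent ℝ (G.blockRows i (B, Om)).row := by
  obtain ⟨Sb, hSb, hP⟩ := h
  have hdisj : (G.induce {i}ᶜ).HasDisjointSystem Sb {v | (v : V) ∈ G.sib i} := hP
  obtain ⟨B, Om, hB, hsymm, hO, hdet, hli⟩ := hdisj.exists_linearIndependent
    (C := {v : ({i}ᶜ : Set V) | (v : V) ∉ G.pa i}) fun v hv hpa => hSb v hv (Or.inl hpa)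
  let extend : Matrix ({i}ᶜ : Set V) ({i}ᶜ : Set V) ℝ → Matrix V V ℝ := fun M =>
    Matrix.of fun a b => if h : a ≠ i ∧ b ≠ i then M ⟨a, h.1⟩ ⟨b, h.2⟩ else 0
  have hsub : ∀ M, (extend M).submatrix (↑) (↑) = M := fun M => by
    ext a b
    exact dif_pos ⟨a.2, b.2⟩
  have hdet' : (bordered (extend Om) i 0 1).det ≠ 0 := by
    rwa [← det_submatrix_compl, hsub]
  refine ⟨extend B, extend Om, fun a b hab => ?_, ?_, fun a b hne hab => ?_, hdet', ?_⟩
  · simp only [extend, Matrix.of_apply, dite_eq_right_iff]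
    exact fun h => hB ⟨a, h.1⟩ ⟨b, h.2⟩ hab
  · ext a b
    simp only [extend, Matrix.transpose_apply, Matrix.of_apply, and_comm (a := b ≠ i)]
    exact dite_congr rfl (fun h => hsymm.apply ⟨a, h.1⟩ ⟨b, h.2⟩) fun _ => rfl
  · simp only [extend, Matrix.of_apply, dite_eq_right_iff]
    exact fun h => hO ⟨a, h.1⟩ ⟨b, h.2⟩ (fun heq => hne (congrArg Subtype.val heq)) hab
  · rw [linearIndependent_blockRows_iff hdet', hsub, hsub]
    exact hli

end MixedGraph

/-! ### A fixed point of the block updates -/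

namespace MixedGraph

variable {V : Type*} [Fintype V] [DecidableEq V] {G : MixedGraph V} {i : V}
  {θ : Matrix V V ℝ × Matrix V V ℝ} {N : ℕ} {Y : Matrix V (Fin N) ℝ}

theorem det_blockGram_ne_zero (hY : LinearIndependent ℝ Y.row)
    (h : LinearIndependent ℝ (G.blockRows i θ).row) : (G.blockGram i θ Y).det ≠ 0 := by
  intro hdet
  obtain ⟨a, ha0, ha⟩ := Matrix.exists_mulVec_eq_zero_iff.2 hdet
  refine ha0 (linearIndependent_row_iff.1 h a (linearIndependent_row_iff.1 hY _ ?_))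
  rw [← dotProduct_self_eq_zero, ← dotProduct_blockGram_mulVec, ha, dotProduct_zero]

theorem sibIncidence_mulVec_single_self : G.sibIncidence i *ᵥ Pi.single i 1 = 0 := by
  ext k
  rw [Matrix.mulVec_single_one]
  rcases k with ⟨j, hj⟩ | ⟨j, hj⟩
  · rfl
  · exact Pi.single_eq_of_ne' hj.ne 1

theorem blockRows_mulVec_inv_mulVec_single (hB : IsUnit (1 - θ.1).det)
    (hdet : (bordered θ.2 i 0 1).det ≠ 0) :
    G.blockRows i θ *ᵥ ((1 - θ.1)⁻¹ *ᵥ Pi.single i 1) =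
      (1 - θ.1).det⁻¹ • G.blockCofactor i θ := by
  have hinv : (bordered θ.2 i 0 1)⁻¹ *ᵥ Pi.single i 1 = Pi.single i 1 := by
    conv_lhs => rw [← one_smul ℝ (Pi.single i 1 : V → ℝ), ← bordered_zero_mulVec_single θ.2 i 1]
    rw [Matrix.mulVec_mulVec, Matrix.nonsing_inv_mul _ hdet.isUnit, Matrix.one_mulVec]
  rw [blockRows, Matrix.add_mulVec, ← Matrix.mulVec_mulVec, ← Matrix.mulVec_mulVec,
    Matrix.mulVec_mulVec _ (1 - θ.1), Matrix.mul_nonsing_inv _ hB, Matrix.one_mulVec, hinv,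
    sibIncidence_mulVec_single_self, add_zero, blockCofactor, ← Matrix.mulVec_smul]
  congr 1
  ext j
  rw [Matrix.mulVec_single_one, Matrix.inv_def, Ring.inverse_eq_inv']
  rfl

section FixedPoint

variable {v : G.BlockIndex i → ℝ} {η : ℝ}

theorem vecMul_blockRows_of_blockPoint_eq (hpt : G.blockPoint i θ v η = θ)
    (hdet : (bordered θ.2 i 0 1).det ≠ 0) :
    v ᵥ* G.blockRows i θ = rowShear i (-G.sibCoeff i θ v) i ᵥ* (1 - θ.1) := by
  have h := rowShear_neg_mul_one_sub_blockPoint v η hdet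
  rw [hpt] at h
  rw [← Matrix.mul_apply_eq_vecMul, h, Matrix.updateRow_self]

theorem rowShear_vecMul_of_blockPoint_eq (hpt : G.blockPoint i θ v η = θ) (hsymm : θ.2.IsSymm)
    (hdet : (bordered θ.2 i 0 1).det ≠ 0) :
    rowShear i (-G.sibCoeff i θ v) i ᵥ* θ.2 = η • Pi.single i 1 := by
  have hu := sibCoeff_self v hdet
  have hOm := blockPoint_snd_eq_rowShear_mul v η hsymm hdet
  rw [hpt] at hOm
  have hmul : rowShear i (-G.sibCoeff i θ v) * θ.2 =
      bordered θ.2 i 0 η * (rowShear i (G.sibCoeff i θ v))ᵀ := by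
    conv_lhs => rw [hOm]
    rw [Matrix.mul_assoc, ← inv_rowShear hu,
      Matrix.nonsing_inv_mul_cancel_left _ _ (by rw [det_rowShear hu]; exact isUnit_one)]
  have hrow : bordered θ.2 i 0 η i = η • Pi.single i 1 := by
    ext b
    simp [bordered, Pi.single_apply]
  have hcol : (rowShear i (G.sibCoeff i θ v))ᵀ i = Pi.single i 1 := by
    ext a
    simp [rowShear, Matrix.one_apply, Pi.single_apply, Matrix.vecMulVec_apply, hu]
  rw [← Matrix.mul_apply_eq_vecMul, hmul, Matrix.mul_apply_eq_vecMul, hrow, Matrix.smul_vecMul,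
    Matrix.single_one_vecMul, Matrix.row, hcol]

theorem blockGram_mulVec_of_blockPoint_eq (hpt : G.blockPoint i θ v η = θ) (hsymm : θ.2.IsSymm)
    (hB : IsUnit (1 - θ.1).det) (hdet : (bordered θ.2 i 0 1).det ≠ 0)
    (hY : Y * Yᵀ = (N : ℝ) • ((1 - θ.1)⁻¹ * θ.2 * (1 - θ.1)⁻¹ᵀ)) :
    G.blockGram i θ Y *ᵥ v = (N * η * (1 - θ.1).det⁻¹) • G.blockCofactor i θ := by
  have hYv : (Y * Yᵀ) *ᵥ (v ᵥ* G.blockRows i θ) =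
      (N * η) • ((1 - θ.1)⁻¹ *ᵥ Pi.single i 1) := by
    rw [vecMul_blockRows_of_blockPoint_eq hpt hdet, hY, ← Matrix.mulVec_transpose (1 - θ.1),
      Matrix.smul_mulVec, Matrix.mulVec_mulVec, Matrix.mul_assoc, ← Matrix.transpose_mul,
      Matrix.mul_nonsing_inv _ hB, Matrix.transpose_one, mul_one, ← Matrix.mulVec_mulVec,
      ← hsymm.eq, Matrix.mulVec_transpose, rowShear_vecMul_of_blockPoint_eq hpt hsymm hdet,
      Matrix.mulVec_smul, smul_smul]
  rw [blockGram, Matrix.transpose_mul, ← Matrix.mul_assoc, Matrix.mul_assoc _ Y,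
    ← Matrix.mulVec_mulVec, Matrix.mulVec_transpose, ← Matrix.mulVec_mulVec, hYv,
    Matrix.mulVec_smul, blockRows_mulVec_inv_mulVec_single hB hdet, smul_smul]

theorem blockUpdate_eq_blockPoint {r : ℝ} (hr : r ≠ 0) (hself : v (G.blockSelf i) = 1)
    (hv : G.blockNormal i θ Y = r • v) :
    G.blockUpdate i θ Y = G.blockPoint i θ v ((G.blockCofactor i θ ⬝ᵥ v) / (N * r)) := by
  rw [blockUpdate, hv, Pi.smul_apply, hself, smul_eq_mul, mul_one, smul_smul, inv_mul_cancel₀ hr,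
    one_smul, dotProduct_smul, smul_eq_mul, sq, mul_left_comm (N : ℝ), mul_div_mul_left _ _ hr]

end FixedPoint

theorem blockUpdate_eq_self (hN : 0 < N) (hB : θ.1 ∈ G.BSet) (hO : θ.2 ∈ G.OmegaSet)
    (hY : Y * Yᵀ = (N : ℝ) • ((1 - θ.1)⁻¹ * θ.2 * (1 - θ.1)⁻¹ᵀ))
    (hA : (G.blockGram i θ Y).det ≠ 0) :
    G.blockNormal i θ Y (G.blockSelf i) ≠ 0 ∧ G.blockUpdate i θ Y = θ := by
  have hν : (N : ℝ) ≠ 0 := Nat.cast_ne_zero.2 hN.ne'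
  have hB' : IsUnit (1 - θ.1).det := (Matrix.isUnit_iff_isUnit_det _).1 hB.1
  have hdet := (posDef_bordered_zero hO.1 i one_pos).det_pos.ne'
  obtain ⟨v, η, hv, hpt⟩ := (mem_blockFeasible_iff (i := i) hB hO).1
    ⟨hB, hO, fun _ _ _ => rfl, fun _ _ _ _ => rfl⟩
  have hcv : G.blockCofactor i θ ⬝ᵥ v = (1 - θ.1).det := by
    rw [← det_one_sub_blockPoint_fst v η, hpt]
  have hη := hv.pos.ne'
  have hr : (1 - θ.1).det / (N * η) ≠ 0 := div_ne_zero hB'.ne_zero (mul_ne_zero hν hη)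
  have hnormal : G.blockNormal i θ Y = ((1 - θ.1).det / (N * η)) • v := by
    have hgram : G.blockCofactor i θ =
        G.blockGram i θ Y *ᵥ (((1 - θ.1).det / (N * η)) • v) := by
      rw [Matrix.mulVec_smul,
        blockGram_mulVec_of_blockPoint_eq hpt (isSymm_of_mem_OmegaSet hO) hB' hdet hY, smul_smul,
        ← div_eq_mul_inv, div_mul_div_cancel₀ (mul_ne_zero hν hη), div_self hB'.ne_zero, one_smul]
    rw [blockNormal, hgram, Matrix.mulVec_mulVec, Matrix.nonsing_inv_mul _ hA.isUnit,
      Matrix.one_mulVec]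
  constructor
  · rwa [hnormal, Pi.smul_apply, hv.apply_self, smul_eq_mul, mul_one]
  · have hvar : (1 - θ.1).det / (N * ((1 - θ.1).det / (N * η))) = η := by
      field_simp [hB'.ne_zero]
    rw [blockUpdate_eq_blockPoint hr hv.apply_self hnormal, hcv, hvar, hpt]

end MixedGraph

/-! ### Regularity of the block updates -/

theorem MatrixRegularAt.bordered {V E : Type*} [DecidableEq V] [AddCommGroup E] [Module ℝ E]
    [MeasurableSpace E] {p : E} {Om : E → Matrix V V ℝ} (hOm : MatrixRegularAt p Om) (i : V)
    {w : E → V → ℝ} (hw : ∀ k, RegularAt p fun x => w x k) {d : E → ℝ} (hd : RegularAt p d) :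
    MatrixRegularAt p fun x => bordered (Om x) i (w x) (d x) := by
  intro a b
  simp only [bordered_apply]
  split_ifs
  exacts [hd, hw b, hw a, hOm a b]

namespace MixedGraph

variable {V : Type*} [Fintype V] [DecidableEq V] {G : MixedGraph V} {i : V} {N : ℕ}

section Regular

variable {E : Type*} [AddCommGroup E] [Module ℝ E] [MeasurableSpace E] {p : E}
  {Y : E → Matrix V (Fin N) ℝ} {θ : E → Matrix V V ℝ × Matrix V V ℝ}

theorem matrixRegularAt_inv_bordered (h₂ : MatrixRegularAt p fun x => (θ x).2)
    (hdet : (bordered (θ p).2 i 0 1).det ≠ 0) :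
    MatrixRegularAt p fun x => (bordered (θ x).2 i 0 1)⁻¹ :=
  (h₂.bordered i (fun _ => .const 0) (.const 1)).inv hdet

theorem matrixRegularAt_blockRows (h₁ : MatrixRegularAt p fun x => (θ x).1)
    (h₂ : MatrixRegularAt p fun x => (θ x).2) (hdet : (bordered (θ p).2 i 0 1).det ≠ 0) :
    MatrixRegularAt p fun x => G.blockRows i (θ x) := fun a b =>
  (RegularAt.const _).add <| (MatrixRegularAt.const _).mul
    ((matrixRegularAt_inv_bordered h₂ hdet).mul ((MatrixRegularAt.const 1).sub h₁)) a b

theorem matrixRegularAt_blockGram (hY : MatrixRegularAt p Y)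
    (h₁ : MatrixRegularAt p fun x => (θ x).1) (h₂ : MatrixRegularAt p fun x => (θ x).2)
    (hdet : (bordered (θ p).2 i 0 1).det ≠ 0) :
    MatrixRegularAt p fun x => G.blockGram i (θ x) (Y x) :=
  have hrows := (matrixRegularAt_blockRows h₁ h₂ hdet).mul hY
  hrows.mul hrows.transpose

theorem regularAt_blockCofactor (h₁ : MatrixRegularAt p fun x => (θ x).1) (k : G.BlockIndex i) :
    RegularAt p fun x => G.blockCofactor i (θ x) k :=
  (MatrixRegularAt.const _).mulVec (fun j => ((MatrixRegularAt.const 1).sub h₁).adjugate j i) k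

theorem regularAt_blockNormal (hY : MatrixRegularAt p Y)
    (h₁ : MatrixRegularAt p fun x => (θ x).1) (h₂ : MatrixRegularAt p fun x => (θ x).2)
    (hdet : (bordered (θ p).2 i 0 1).det ≠ 0) (hA : (G.blockGram i (θ p) (Y p)).det ≠ 0)
    (k : G.BlockIndex i) : RegularAt p fun x => G.blockNormal i (θ x) (Y x) k :=
  ((matrixRegularAt_blockGram hY h₁ h₂ hdet).inv hA).mulVec (regularAt_blockCofactor h₁) k

theorem matrixRegularAt_blockPoint_fst (h₁ : MatrixRegularAt p fun x => (θ x).1)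
    {v : E → G.BlockIndex i → ℝ} (hv : ∀ k, RegularAt p fun x => v x k) (η : E → ℝ) :
    MatrixRegularAt p fun x => (G.blockPoint i (θ x) (v x) (η x)).1 := by
  intro a b
  by_cases ha : a = i
  · subst ha
    simp only [blockPoint, Matrix.updateRow_self]
    exact (RegularAt.const _).sub (MatrixRegularAt.vecMul hv (.const _) b)
  · simp only [blockPoint, Matrix.updateRow_ne ha]
    exact h₁ a b

theorem matrixRegularAt_blockPoint_snd (h₂ : MatrixRegularAt p fun x => (θ x).2)
    (hdet : (bordered (θ p).2 i 0 1).det ≠ 0) {v : E → G.BlockIndex i → ℝ}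
    (hv : ∀ k, RegularAt p fun x => v x k) {η : E → ℝ} (hη : RegularAt p η) :
    MatrixRegularAt p fun x => (G.blockPoint i (θ x) (v x) (η x)).2 := by
  have hw : ∀ k, RegularAt p fun x => (-(v x ᵥ* G.sibIncidence i)) k := fun k =>
    (MatrixRegularAt.vecMul hv (.const _) k).neg
  exact h₂.bordered i hw <| hη.add <|
    RegularAt.dotProduct (MatrixRegularAt.vecMul hw (matrixRegularAt_inv_bordered h₂ hdet)) hw

theorem matrixRegularAt_blockUpdate (hN : 0 < N) (hY : MatrixRegularAt p Y)
    (h₁ : MatrixRegularAt p fun x => (θ x).1) (h₂ : MatrixRegularAt p fun x => (θ x).2)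
    (hdet : (bordered (θ p).2 i 0 1).det ≠ 0) (hA : (G.blockGram i (θ p) (Y p)).det ≠ 0)
    (hself : G.blockNormal i (θ p) (Y p) (G.blockSelf i) ≠ 0) :
    (MatrixRegularAt p fun x => (G.blockUpdate i (θ x) (Y x)).1) ∧
      MatrixRegularAt p fun x => (G.blockUpdate i (θ x) (Y x)).2 := by
  have hnormal := regularAt_blockNormal hY h₁ h₂ hdet hA
  have hv : ∀ k, RegularAt p fun x =>
      ((G.blockNormal i (θ x) (Y x) (G.blockSelf i))⁻¹ • G.blockNormal i (θ x) (Y x)) k :=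
    fun k => ((hnormal _).inv hself).mul (hnormal k)
  have hden : RegularAt p fun x => (N : ℝ) * G.blockNormal i (θ x) (Y x) (G.blockSelf i) ^ 2 := by
    simpa only [pow_two] using (RegularAt.const _).mul ((hnormal _).mul (hnormal _))
  have hη := (RegularAt.dotProduct (regularAt_blockCofactor h₁) hnormal).div hden
    (mul_ne_zero (Nat.cast_ne_zero.2 hN.ne') (pow_ne_zero 2 hself))
  exact ⟨matrixRegularAt_blockPoint_fst h₁ hv _, matrixRegularAt_blockPoint_snd h₂ hdet hv hη⟩

end Regular

variable {E : Type*} [NormedAddCommGroup E] [NormedSpace ℝ E] [FiniteDimensional ℝ E]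
  [MeasurableSpace E] [BorelSpace E] {p : E} {Y : E → Matrix V (Fin N) ℝ}

theorem ae_uniqueFeasibleUpdates (μ : Measure E) [μ.IsAddHaarMeasure] (hN : 0 < N)
    (hY : MatrixRegularAt p Y) {θ₀ : Matrix V V ℝ × Matrix V V ℝ} (hB : θ₀.1 ∈ G.BSet)
    (hO : θ₀.2 ∈ G.OmegaSet)
    (hcov : Y p * (Y p)ᵀ = (N : ℝ) • ((1 - θ₀.1)⁻¹ * θ₀.2 * (1 - θ₀.1)⁻¹ᵀ)) {l : List V}
    (hA : ∀ i ∈ l, (G.blockGram i θ₀ (Y p)).det ≠ 0) {θ : E → Matrix V V ℝ × Matrix V V ℝ}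
    (hp : θ p = θ₀) (h₁ : MatrixRegularAt p fun x => (θ x).1)
    (h₂ : MatrixRegularAt p fun x => (θ x).2) :
    ∀ᵐ x ∂μ, (θ x).1 ∈ G.BSet → (θ x).2 ∈ G.OmegaSet → G.UniqueFeasibleUpdates (Y x) l (θ x) := by
  induction l generalizing θ with
  | nil => exact .of_forall fun _ _ _ => trivial
  | cons i l ih =>
    subst hp
    have hdet := (posDef_bordered_zero hO.1 i one_pos).det_pos.ne'
    have hAi := hA i List.mem_cons_self
    obtain ⟨hself, hfix⟩ := blockUpdate_eq_self hN hB hO hcov hAi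
    obtain ⟨h₁', h₂'⟩ := matrixRegularAt_blockUpdate hN hY h₁ h₂ hdet hAi hself
    have hl := ih (fun j hj => hA j (List.mem_cons_of_mem i hj))
      (θ := fun x => G.blockUpdate i (θ x) (Y x)) hfix h₁' h₂'
    filter_upwards [(matrixRegularAt_blockGram hY h₁ h₂ hdet).det.ae_ne_zero μ hAi,
      (regularAt_blockNormal hY h₁ h₂ hdet hAi (G.blockSelf i)).ae_ne_zero μ hself, hl]
      with x hAx hselfx hlx hBx hOx
    have hsol : ∀ θ', G.IsBlockSolution (Y x) i (θ x) θ' ↔ θ' = G.blockUpdate i (θ x) (Y x) :=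
      fun _ => isBlockSolution_iff_eq_blockUpdate hN hBx hOx hAx hselfx
    have hfeas := ((hsol _).2 rfl).1
    exact ⟨_, ⟨(hsol _).2 rfl, fun θ' => (hsol θ').1⟩, hlx hfeas.1 hfeas.2.1⟩

end MixedGraph

/-! ### Generic data and starting values -/

open Topology in
theorem eventually_posDef_of_isSymm {n : Type*} [Finite n] {A : Matrix n n ℝ} (hA : A.PosDef) :
    ∀ᶠ M in 𝓝 A, M.IsSymm → M.PosDef := by
  have := Fintype.ofFinite n
  have hsphere : ∀ᶠ M in 𝓝 A, ∀ x ∈ Metric.sphere (0 : n → ℝ) 1, 0 < x ⬝ᵥ M *ᵥ x := by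
    refine (isCompact_sphere (0 : n → ℝ) 1).eventually_forall_of_forall_eventually fun x hx => ?_
    have hcont : Continuous fun z : Matrix n n ℝ × (n → ℝ) => z.2 ⬝ᵥ z.1 *ᵥ z.2 := by fun_prop
    refine hcont.continuousAt.eventually (lt_mem_nhds ?_)
    simpa using hA.dotProduct_mulVec_pos (ne_zero_of_mem_unit_sphere ⟨x, hx⟩)
  filter_upwards [hsphere] with M hM hs
  refine Matrix.PosDef.of_dotProduct_mulVec_pos (by simpa using hs) fun x hx => ?_
  have hnorm : 0 < ‖x‖ := norm_pos_iff.2 hx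
  have hpos := hM (‖x‖⁻¹ • x) (by simp [norm_smul, hnorm.ne'])
  rw [Matrix.mulVec_smul, dotProduct_smul, smul_dotProduct, smul_eq_mul, smul_eq_mul,
    ← mul_assoc] at hpos
  rw [star_trivial]
  exact (pos_iff_pos_of_mul_pos hpos).1 (by positivity)

open scoped MatrixOrder Matrix.Norms.L2Operator in
theorem exists_mul_transpose_eq_of_posSemidef {m n : Type*} [Fintype m] [Fintype n]
    (h : Fintype.card m ≤ Fintype.card n) {S : Matrix m m ℝ} (hS : S.PosSemidef) :
    ∃ Y : Matrix m n ℝ, Y * Yᵀ = S := by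
  classical
  obtain ⟨M, rfl⟩ := CStarAlgebra.nonneg_iff_eq_star_mul_self.mp hS.nonneg
  obtain ⟨f⟩ := Function.Embedding.nonempty_of_card_le h
  have hone : (1 : Matrix n n ℝ).submatrix f id * ((1 : Matrix n n ℝ).submatrix f id)ᵀ = 1 := by
    rw [Matrix.transpose_submatrix, Matrix.transpose_one,
      ← Matrix.submatrix_mul _ _ _ _ _ Function.bijective_id, Matrix.one_mul,
      Matrix.submatrix_one f f.injective]
  refine ⟨Mᵀ * (1 : Matrix n n ℝ).submatrix f id, ?_⟩
  rw [Matrix.transpose_mul, Matrix.transpose_transpose, Matrix.mul_assoc, ← Matrix.mul_assoc _ _ M,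
    hone, Matrix.one_mul, Matrix.star_eq_conjTranspose,
    Matrix.conjTranspose_eq_transpose_of_trivial]

theorem linearIndependent_row_of_det_mul_ne_zero {m n R : Type*} [Fintype m] [DecidableEq m]
    [Fintype n] [CommRing R] [IsDomain R] {Y : Matrix m n R} {Z : Matrix n m R}
    (h : (Y * Z).det ≠ 0) : LinearIndependent R Y.row := by
  refine linearIndependent_row_iff.2 fun y hy => Matrix.eq_zero_of_vecMul_eq_zero h ?_
  rw [← Matrix.vecMul_vecMul, hy, Matrix.zero_vecMul]

theorem exists_mul_transpose_eq_smul_covariance {n : Type*} [Fintype n] [DecidableEq n] {N : ℕ}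
    (hN : 0 < N) (hcard : Fintype.card n ≤ N) {B Om : Matrix n n ℝ} (hB : IsUnit (1 - B))
    (hOm : Om.PosDef) : ∃ Y : Matrix n (Fin N) ℝ,
      Y * Yᵀ = (N : ℝ) • ((1 - B)⁻¹ * Om * (1 - B)⁻¹ᵀ) ∧ LinearIndependent ℝ Y.row := by
  have hcov : ((N : ℝ) • ((1 - B)⁻¹ * Om * (1 - B)⁻¹ᵀ)).PosDef :=
    ((Matrix.IsUnit.posDef_star_right_conjugate_iff
      (Matrix.isUnit_nonsing_inv_iff.2 hB)).2 hOm).smul (Nat.cast_pos.2 hN)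
  obtain ⟨Y, hY⟩ := exists_mul_transpose_eq_of_posSemidef (n := Fin N) (by simpa using hcard)
    hcov.posSemidef
  refine ⟨Y, hY, linearIndependent_row_of_det_mul_ne_zero (Z := Yᵀ) ?_⟩
  rw [hY]
  exact hcov.det_pos.ne'

namespace MixedGraph

section Coordinates

variable {V : Type*} (G : MixedGraph V)

theorem dirSupported_toB (β : G.DirEdge → ℝ) : G.DirSupported (G.toB β) := fun a b h => by
  simp [toB, h]

theorem exists_toB_eq {B : Matrix V V ℝ} (hB : G.DirSupported B) : ∃ β, G.toB β = B := by
  refine ⟨fun e => B e.1.2 e.1.1, Matrix.ext fun a b => ?_⟩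
  by_cases h : G.dir b a
  · simp [toB, h]
  · simp [toB, h, hB a b h]

theorem continuous_toB : Continuous G.toB := by
  refine continuous_matrix fun a b => ?_
  simp only [toB, Matrix.of_apply]
  split_ifs <;> fun_prop

variable [DecidableEq V]

theorem isSymm_toOmega (ω : G.OmegaIndex → ℝ) : (G.toOmega ω).IsSymm := by
  refine Matrix.IsSymm.ext fun a b => ?_
  by_cases hab : a = b
  · rw [hab]
  · by_cases h : G.bi.Adj a b
    · simp [toOmega, hab, Ne.symm hab, h, Sym2.eq_swap (a := b)]
    · simp [toOmega, hab, Ne.symm hab, h, G.bi.adj_comm b a]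

theorem biSupported_toOmega (ω : G.OmegaIndex → ℝ) : G.BiSupported (G.toOmega ω) :=
  fun a b hab h => by simp [toOmega, hab, G.bi.adj_comm a b, h]

theorem exists_toOmega_eq {Om : Matrix V V ℝ} (hsymm : Om.IsSymm) (hOm : G.BiSupported Om) :
    ∃ ω, G.toOmega ω = Om := by
  refine ⟨Sum.elim (fun i => Om i i)
    fun e => e.1.lift ⟨fun a b => Om a b, fun a b => hsymm.apply b a⟩, Matrix.ext fun a b => ?_⟩
  by_cases hab : a = b
  · subst hab
    simp [toOmega]
  · by_cases h : G.bi.Adj b a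
    · simp [toOmega, hab, h.symm]
    · simp [toOmega, hab, hOm a b hab h]

theorem continuous_toOmega : Continuous G.toOmega := by
  refine continuous_matrix fun a b => ?_
  simp only [toOmega, Matrix.of_apply]
  split_ifs <;> fun_prop

end Coordinates

/-- The coordinates of triples `(Y, B, Ω)`: the entries of `Y` and the free entries of `B` and
`Ω`. -/
abbrev TripleCoord {V : Type*} (G : MixedGraph V) (N : ℕ) : Type _ :=
  (V → Fin N → ℝ) × (G.DirEdge → ℝ) × (G.OmegaIndex → ℝ)

section Regular

variable {V : Type*} {G : MixedGraph V} {N : ℕ} (p : G.TripleCoord N)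

theorem matrixRegularAt_data : MatrixRegularAt p fun x => Matrix.of x.1 := fun a b =>
  .of_isLinearMap ⟨fun _ _ => rfl, fun _ _ => rfl⟩ (by simp only [Matrix.of_apply]; fun_prop)

theorem matrixRegularAt_toB : MatrixRegularAt p fun x => G.toB x.2.1 := fun a b => by
  simp only [toB, Matrix.of_apply]
  split_ifs
  · exact .of_isLinearMap ⟨fun _ _ => rfl, fun _ _ => rfl⟩ (by fun_prop)
  · exact .const 0

theorem matrixRegularAt_toOmega [DecidableEq V] :
    MatrixRegularAt p fun x => G.toOmega x.2.2 := fun a b => by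
  simp only [toOmega, Matrix.of_apply]
  split_ifs
  · exact .of_isLinearMap ⟨fun _ _ => rfl, fun _ _ => rfl⟩ (by fun_prop)
  · exact .of_isLinearMap ⟨fun _ _ => rfl, fun _ _ => rfl⟩ (by fun_prop)
  · exact .const 0

end Regular

open Topology in
theorem exists_eventually_mem_BSet_and_mem_OmegaSet {V : Type*} [Fintype V] [DecidableEq V]
    {G : MixedGraph V} {N : ℕ} : ∃ p₀ : G.TripleCoord N, ∀ᶠ p in 𝓝 p₀,
    G.toB p.2.1 ∈ G.BSet ∧ G.toOmega p.2.2 ∈ G.OmegaSet := by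
  obtain ⟨β, hβ⟩ := G.exists_toB_eq (B := 0) fun _ _ _ => rfl
  obtain ⟨ω, hω⟩ := G.exists_toOmega_eq (Om := 1) Matrix.isSymm_one
    fun _ _ h _ => Matrix.one_apply_ne h
  have hdet : Continuous fun p : G.TripleCoord N => (1 - G.toB p.2.1).det :=
    (continuous_const.sub (G.continuous_toB.comp (by fun_prop))).matrix_det
  have hOmega : Continuous fun p : G.TripleCoord N => G.toOmega p.2.2 :=
    G.continuous_toOmega.comp (by fun_prop)
  have hone : (G.toOmega ω).PosDef := hω ▸ Matrix.PosDef.one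
  refine ⟨(0, β, ω), ?_⟩
  filter_upwards [hdet.continuousAt.eventually_ne (y := 0) (by simp [hβ]),
    (hOmega.tendsto (0, β, ω)).eventually (eventually_posDef_of_isSymm hone)] with p hp₁ hp₂
  exact ⟨⟨(Matrix.isUnit_iff_isUnit_det _).2 hp₁.isUnit, G.dirSupported_toB _⟩,
    hp₂ (G.isSymm_toOmega _), G.biSupported_toOmega _⟩

section Generic

variable {V : Type*} [Fintype V] {G : MixedGraph V} [Fintype G.DirEdge]
  [Fintype G.OmegaIndex] {N : ℕ}

instance : (volume : Measure (G.TripleCoord N)).IsAddHaarMeasure :=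
  have : (volume : Measure (V → Fin N → ℝ)).IsAddHaarMeasure := Measure.pi.isAddHaarMeasure _
  have : (volume : Measure ((G.DirEdge → ℝ) × (G.OmegaIndex → ℝ))).IsAddHaarMeasure :=
    Measure.prod.instIsAddHaarMeasure _ _
  Measure.prod.instIsAddHaarMeasure _ _

variable [DecidableEq V]

theorem exists_feasible_of_ae {Q : G.TripleCoord N → Prop} (hQ : ∀ᵐ p, Q p) :
    ∃ p, Q p ∧ G.toB p.2.1 ∈ G.BSet ∧ G.toOmega p.2.2 ∈ G.OmegaSet := by
  obtain ⟨p₀, hp₀⟩ := exists_eventually_mem_BSet_and_mem_OmegaSet (G := G) (N := N)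
  obtain ⟨p, hp, hpQ⟩ := (Measure.dense_of_ae hQ).inter_nhds_nonempty hp₀
  exact ⟨p, hp, hpQ⟩

theorem HalfColliderCondition.ae_linearIndependent_blockRows {i : V}
    (h : G.HalfColliderCondition i) (hN : Fintype.card V ≤ N) : ∀ᵐ p : G.TripleCoord N,
      LinearIndependent ℝ (G.blockRows i (G.toB p.2.1, G.toOmega p.2.2)).row := by
  obtain ⟨B, Om, hB, hsymm, hOm, hdet, hrows⟩ := h.exists_linearIndependent
  obtain ⟨β, rfl⟩ := G.exists_toB_eq hB
  obtain ⟨ω, rfl⟩ := G.exists_toOmega_eq hsymm hOm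
  obtain ⟨Y, hY⟩ := exists_mul_transpose_eq_of_posSemidef (n := Fin N) (by simpa using hN)
    (Matrix.PosDef.one (n := V) (R := ℝ)).posSemidef
  let p : G.TripleCoord N := (Y, β, ω)
  have hA : (G.blockGram i (G.toB β, G.toOmega ω) Y).det ≠ 0 := by
    refine det_blockGram_ne_zero (linearIndependent_row_of_det_mul_ne_zero (Z := Yᵀ) ?_) hrows
    simp [hY]
  filter_upwards [(matrixRegularAt_blockGram (p := p) (matrixRegularAt_data p)
    (θ := fun x => (G.toB x.2.1, G.toOmega x.2.2)) (matrixRegularAt_toB p)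
    (matrixRegularAt_toOmega p) hdet).det.ae_ne_zero volume hA] with x hx
  rw [blockGram, Matrix.mul_assoc] at hx
  exact linearIndependent_row_of_det_mul_ne_zero hx

theorem ae_uniqueFeasibleUpdates_of_halfColliderCondition (hN : Fintype.card V ≤ N) {l : List V}
    (h : ∀ i ∈ l, G.HalfColliderCondition i) :
    ∀ᵐ p : G.TripleCoord N, G.toB p.2.1 ∈ G.BSet → G.toOmega p.2.2 ∈ G.OmegaSet →
      G.UniqueFeasibleUpdates (Matrix.of p.1) l (G.toB p.2.1, G.toOmega p.2.2) := by
  rcases eq_or_ne l [] with rfl | hl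
  · exact .of_forall fun _ _ _ => trivial
  obtain ⟨i, -⟩ := List.exists_mem_of_ne_nil l hl
  have hN₀ : 0 < N := (Fintype.card_pos_iff.2 ⟨i⟩).trans_le hN
  obtain ⟨⟨_, β, ω⟩, hrows, hB, hO⟩ := exists_feasible_of_ae <| ae_all_iff.2 fun j =>
    Filter.eventually_imp_distrib_left.2 fun hj => (h j hj).ae_linearIndependent_blockRows hN
  obtain ⟨Y, hcov, hY⟩ := exists_mul_transpose_eq_smul_covariance hN₀ hN hB.1 hO.1
  let p : G.TripleCoord N := (Y, β, ω)
  exact ae_uniqueFeasibleUpdates (p := p) (Y := fun x => Matrix.of x.1)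
    (θ₀ := (G.toB β, G.toOmega ω)) (θ := fun x => (G.toB x.2.1, G.toOmega x.2.2)) volume hN₀
    (matrixRegularAt_data p) hB hO hcov (fun j hj => det_blockGram_ne_zero hY (hrows j hj)) rfl
    (matrixRegularAt_toB p) (matrixRegularAt_toOmega p)

end Generic

theorem UniqueFeasibleUpdates.exists_isBlockSolution_of_mem {V : Type*} [Fintype V] [DecidableEq V]
    {G : MixedGraph V} {N : ℕ} {Y : Matrix V (Fin N) ℝ} {l : List V}
    {θ : Matrix V V ℝ × Matrix V V ℝ} (h : G.UniqueFeasibleUpdates Y l θ) (hB : θ.1 ∈ G.BSet)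
    (hO : θ.2 ∈ G.OmegaSet) {i : V} (hi : i ∈ l) :
    ∃ θ₁ θ₂ : Matrix V V ℝ × Matrix V V ℝ, θ₁.1 ∈ G.BSet ∧ θ₁.2 ∈ G.OmegaSet ∧
      G.IsBlockSolution Y i θ₁ θ₂ ∧ ∀ θ₃, G.IsBlockSolution Y i θ₁ θ₃ → θ₃ = θ₂ := by
  induction l generalizing θ with
  | nil => exact absurd hi List.not_mem_nil
  | cons j l ih =>
    obtain ⟨θ', ⟨hsol, huniq⟩, hl⟩ := h
    rcases List.mem_cons.1 hi with rfl | hi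
    · exact ⟨θ, θ', hB, hO, hsol, huniq⟩
    · exact ih hl hsol.1.1 hsol.1.2.1 hi

end MixedGraph

theorem mainTheorem1_general {V : Type*} [Fintype V] [DecidableEq V] (G : MixedGraph V) (N : ℕ)
    (hN : Fintype.card V ≤ N) (order : List V) :
    (∀ i ∈ order, G.HalfColliderCondition i) ↔
      G.ForGenericTriples N (fun Y θ₀ =>
        ∀ T : ℕ, G.UniqueFeasibleUpdates Y (List.replicate T order).flatten θ₀) := by
  classical
  constructor
  · intro h
    have hT := ae_all_iff.2 fun T : ℕ =>
      MixedGraph.ae_uniqueFeasibleUpdates_of_halfColliderCondition hN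
        (l := (List.replicate T order).flatten) fun i hi => by
          obtain ⟨l, hl, hil⟩ := List.mem_flatten.1 hi
          exact h i (List.eq_of_mem_replicate hl ▸ hil)
    exact hT.mono fun p hp hB hO T => hp T hB hO
  · intro h i hi
    obtain ⟨p, hp, hB, hO⟩ := MixedGraph.exists_feasible_of_ae h
    have hupdates := hp hB hO 1
    rw [List.replicate_one, List.flatten_singleton] at hupdates
    obtain ⟨θ₁, θ₂, hB₁, hO₁, hsol, huniq⟩ := hupdates.exists_isBlockSolution_of_mem hB hO hi
    exact MixedGraph.halfColliderCondition_of_linearIndependent hB₁.2 hO₁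
      (MixedGraph.linearIndependent_blockRows_of_unique hB₁ hO₁ hsol huniq)

theorem mainTheorem1 {V : Type*} [Fintype V] [DecidableEq V] (G : MixedGraph V) (N : ℕ)
    (hN : Fintype.card V ≤ N) (order : List V) (h_nodup : order.Nodup)
    (h_all : ∀ v, v ∈ order) :
    (∀ i : V, G.HalfColliderCondition i) ↔
      G.ForGenericTriples N (fun Y θ₀ =>
        ∀ T : ℕ, G.UniqueFeasibleUpdates Y (List.replicate T order).flatten θ₀) := by
  rw [← mainTheorem1_general G N hN order]
  exact ⟨fun h i _ => h i, fun h i => h i (h_all i)⟩
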